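/- Let $d\ge 1$ be an integer, $p\in[0,1]$ and $\varepsilon\in(0,1)$. Let $\mathcal E_p$ be the quantum erasure channel with input space $\mathbb C^d$ and output space $\mathbb C^d\oplus\mathbb C|e\rangle$ (with $|e\rangle$ a unit vector orthogonal to $\mathbb C^d$), $\mathcal E_p(\rho)=(1-p)\rho+p\,\mathrm{tr}(\rho)\,|e\rangle\langle e|$. For a quantum channel $\mathcal N$ (a completely positive trace-preserving linear map between operators on finite-dimensional Hilbert spaces) and an integer $m\ge 1$ let $$p_{\rm succ}(\mathcal N,m)=\sup_{\mathcal F,\mathcal D}\ \frac1m\sum_{k=1}^m \mathrm{tr}\big[(\mathcal D\circ\mathcal N\circ\mathcal F)(|k\rangle\langle k|)\,|k\rangle\langle k|\big],$$ where the supremum is over all encoding channels $\mathcal F$ from operators on $\mathbb C^m$ to the input of $\mathcal N$ and all decoding channels $\mathcal D$ from the output of $\mathcal N$ to operators on $\mathbb C^m$, and let $$C^{(1)}(\mathcal N,\varepsilon)=\sup\{\log m\ :\ m\ge 1,\ p_{\rm succ}(\mathcal N,m)\ge 1-\varepsilon\}$$ (logarithms are to base 2). Then $C^{(1)}(\mathcal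 E_p^{\otimes n},\varepsilon)$ is finite for every $n$ and, as $n\to\infty$, $$C^{(1)}(\mathcal E_p^{\otimes n},\varepsilon)=n(1-p)\log d+\sqrt{n\,p(1-p)(\log d)^2}\;\Phi^{-1}(\varepsilon)+O(\log n),$$ where $\Phi$ is the cumulative distribution function of a standard normal random variable and the constant implied by $O(\log n)$ may depend on $d$, $p$ and $\varepsilon$. -/

import Mathlib

open scoped ComplexOrder

noncomputable section

namespace QErasure

/-- The map `id_k ⊗ Φ` on operators on `ℂ^k ⊗ A`: apply `Φ` to each `A`-block. -/
def ampliation {A B : Type*} (k : ℕ) (Φ : Matrix A A ℂ →ₗ[ℂ] Matrix B B ℂ)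
    (X : Matrix (Fin k × A) (Fin k × A) ℂ) : Matrix (Fin k × B) (Fin k × B) ℂ :=
  Matrix.of fun x y => Φ (Matrix.of fun a a' => X (x.1, a) (y.1, a')) x.2 y.2

/-- Complete positivity: every `id_k ⊗ Φ` maps positive semidefinite operators to
positive semidefinite operators. -/
def IsCompletelyPositive {A B : Type*} (Φ : Matrix A A ℂ →ₗ[ℂ] Matrix B B ℂ) : Prop :=
  ∀ (k : ℕ) (X : Matrix (Fin k × A) (Fin k × A) ℂ),
    X.PosSemidef → (ampliation k Φ X).PosSemidef

/-- Trace preservation. -/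
def IsTracePreserving {A B : Type*} [Fintype A] [Fintype B]
    (Φ : Matrix A A ℂ →ₗ[ℂ] Matrix B B ℂ) : Prop :=
  ∀ X : Matrix A A ℂ, (Φ X).trace = X.trace

/-- A quantum channel: a completely positive trace-preserving linear map. -/
def IsChannel {A B : Type*} [Fintype A] [Fintype B]
    (Φ : Matrix A A ℂ →ₗ[ℂ] Matrix B B ℂ) : Prop :=
  IsCompletelyPositive Φ ∧ IsTracePreserving Φ

/-- The tensor power `N^{⊗n}`, acting on operators on `A^{⊗n}` (with basis `Fin n → A`): by
linearity, `|a⟩⟨a'| = ⊗ᵢ |aᵢ⟩⟨a'ᵢ|` is sent to `⊗ᵢ N(|aᵢ⟩⟨a'ᵢ|)`. -/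
def tensorPower {A B : Type*} [Fintype A] [DecidableEq A]
    (N : Matrix A A ℂ →ₗ[ℂ] Matrix B B ℂ) (n : ℕ) :
    Matrix (Fin n → A) (Fin n → A) ℂ →ₗ[ℂ] Matrix (Fin n → B) (Fin n → B) ℂ where
  toFun X := Matrix.of fun b b' =>
    ∑ a, ∑ a', X a a' * ∏ i, N (Matrix.single (a i) (a' i) 1) (b i) (b' i)
  map_add' X Y := by
    ext b b'
    simp [add_mul, Finset.sum_add_distrib]
  map_smul' c X := by
    ext b b'
    simp [Finset.mul_sum, mul_assoc]

/-- The average success probability over `m` messages of the unassisted code consisting of the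
encoder `enc` and the decoder `dec`; the effective channel is `M = dec ∘ N ∘ enc`, and the
value is `(1/m) ∑ₖ tr (M(|k⟩⟨k|) |k⟩⟨k|)`. -/
def codeSuccess {A B : Type*} (N : Matrix A A ℂ →ₗ[ℂ] Matrix B B ℂ) (m : ℕ)
    (enc : Matrix (Fin m) (Fin m) ℂ →ₗ[ℂ] Matrix A A ℂ)
    (dec : Matrix B B ℂ →ₗ[ℂ] Matrix (Fin m) (Fin m) ℂ) : ℝ :=
  (1 / (m : ℝ)) * ∑ k : Fin m,
    (Matrix.trace (dec (N (enc (Matrix.single k k 1))) * Matrix.single k k 1)).re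

/-- The optimal average success probability of transmitting `m` messages over `N` with
unassisted codes. -/
def pSucc {A B : Type*} [Fintype A] [Fintype B]
    (N : Matrix A A ℂ →ₗ[ℂ] Matrix B B ℂ) (m : ℕ) : ℝ :=
  sSup {s : ℝ | ∃ (enc : Matrix (Fin m) (Fin m) ℂ →ₗ[ℂ] Matrix A A ℂ)
    (dec : Matrix B B ℂ →ₗ[ℂ] Matrix (Fin m) (Fin m) ℂ),
    IsChannel enc ∧ IsChannel dec ∧ s = codeSuccess N m enc dec}

/-- The one-shot `ε`-error classical capacity
`C⁽¹⁾(N, ε) = sup {log₂ m | m ≥ 1, p_succ(N, m) ≥ 1 - ε}`, an extended real number. -/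
def oneShotCapacity {A B : Type*} [Fintype A] [Fintype B]
    (N : Matrix A A ℂ →ₗ[ℂ] Matrix B B ℂ) (ε : ℝ) : EReal :=
  sSup {r : EReal | ∃ m : ℕ, 1 ≤ m ∧ 1 - ε ≤ pSucc N m ∧ r = ((Real.logb 2 m : ℝ) : EReal)}

/-- The `d`-dimensional quantum erasure channel `ρ ↦ (1 - p) ρ ⊕ p tr(ρ) |e⟩⟨e|`; the output
space is `ℂ^d ⊕ ℂ|e⟩`, where `Sum.inr ()` is the index of `|e⟩`. -/
def erasureChannel (d : ℕ) (p : ℝ) :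
    Matrix (Fin d) (Fin d) ℂ →ₗ[ℂ] Matrix (Fin d ⊕ Unit) (Fin d ⊕ Unit) ℂ where
  toFun ρ := Matrix.fromBlocks ((1 - (p : ℂ)) • ρ) 0 0 (Matrix.of fun _ _ => (p : ℂ) * ρ.trace)
  map_add' ρ σ := by
    ext (i | i) (j | j) <;> simp [mul_add]
  map_smul' c ρ := by
    ext (i | i) (j | j) <;> simp [mul_left_comm]

/-- The inverse `Φ⁻¹` on `(0, 1)` of the cumulative distribution function `Φ` of a standard
normal random variable. -/
def stdNormalQuantile (ε : ℝ) : ℝ :=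
  sInf {x : ℝ | ε ≤ ProbabilityTheory.cdf (ProbabilityTheory.gaussianReal 0 1) x}

end QErasure

end

/-!
# Second-order classical capacity of the quantum erasure channel

Let `K` be the number of unerased sites among `n`, a binomial variable with success probability
`q = 1 - p`. The `n`-fold erasure channel announces which sites it erases and transmits the others
perfectly, so everything reduces to the distribution of `K`.

*Converse.* The `n`-fold channel is the mixture, over the sets `t` of kept sites, of the maps
`keptOutput t`, whose output states are dominated by a projection of rank `d ^ #t`
(`posSemidef_patternInd_sub_keptOutput`). A decoder distinguishes `m` messages in a space of
dimension `d ^ #t` with average success probability at most `min (1, d ^ #t / m)`; averaging over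
`t` gives `codeSuccess_le`.

*Achievability.* Random classical codewords in `[d]^n`, decoded by matching the unerased symbols,
fail for a given `t` only if another codeword agrees on `t`, an event of probability at most
`(m - 1) / d ^ #t`; this gives `le_pSucc`.

Hence the capacity is, up to `log (1 / δ)`, equal to `j log d` for any `j` such that `P(K < j)` is
within the scale `δ` of `ε` on the appropriate side (`oneShotCapacity_le`, `le_oneShotCapacity`).
With `δ` of order `1 / √n` the loss is `O(log n)`, and it remains to see that such a `j` is
`n q + √(n q p) Φ⁻¹(ε) + O(1)` (`exists_binLT_quantile`). This needs a Berry–Esseen bound of order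
`1 / √n` for the binomial law (`binLT_sub_stdCDF_le`), which is proved by Stein's method. The
binomial law satisfies the exact identity
`E_{n+1}[(K - (n+1) q) F(K)] = (n+1) q p E_n[F(K+1) - F(K)]` (`binExp_stein`). For the solution `f`
of Stein's equation `f'(w) - w f(w) = 1_{w ≤ z} - Φ(z)` with `z` a point of the rescaled lattice,
the right-hand side is a sum of increments over intervals on which `f` is smooth, and the mean
value theorem (`stein_increment`) turns the identity into the bound.
-/

open scoped ComplexOrder

noncomputable section

namespace QErasure

/-! ### The standard normal law and Stein's equation -/

section Normal

open ProbabilityTheory MeasureTheory Filter Set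
open scoped Topology

/-- The cumulative distribution function of the standard normal law. -/
def stdCDF (x : ℝ) : ℝ := cdf (gaussianReal 0 1) x

/-- The density of the standard normal law. -/
def stdPDF (x : ℝ) : ℝ := gaussianPDFReal 0 1 x

lemma stdPDF_eq (x : ℝ) : stdPDF x = (√(2 * Real.pi))⁻¹ * Real.exp (-x ^ 2 / 2) := by
  simp [stdPDF, gaussianPDFReal]

lemma stdPDF_pos (x : ℝ) : 0 < stdPDF x := gaussianPDFReal_pos 0 1 x one_ne_zero

lemma stdPDF_neg (x : ℝ) : stdPDF (-x) = stdPDF x := by simp [stdPDF_eq]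

lemma hasDerivAt_stdPDF (x : ℝ) : HasDerivAt stdPDF (-x * stdPDF x) x := by
  have h1 : HasDerivAt (fun x : ℝ => -x ^ 2 / 2) (-x) x := by
    have := ((hasDerivAt_pow 2 x).neg).div_const 2
    convert! this using 1
    norm_num
    ring
  have h2 := h1.exp.const_mul (√(2 * Real.pi))⁻¹
  rw [show stdPDF = fun x => (√(2 * Real.pi))⁻¹ * Real.exp (-x ^ 2 / 2) from funext stdPDF_eq]
  convert! h2 using 1
  ring

lemma continuous_stdPDF : Continuous stdPDF :=
  continuous_iff_continuousAt.2 fun x => (hasDerivAt_stdPDF x).continuousAt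

lemma tendsto_stdPDF_atBot : Tendsto stdPDF atBot (𝓝 0) := by
  rw [show stdPDF = fun x => (√(2 * Real.pi))⁻¹ * Real.exp (-x ^ 2 / 2) from funext stdPDF_eq]
  rw [show (0 : ℝ) = (√(2 * Real.pi))⁻¹ * 0 by simp]
  refine Tendsto.const_mul _ (Real.tendsto_exp_atBot.comp ?_)
  have h : Tendsto (fun x : ℝ => x ^ 2) atBot atTop := by
    simpa [Function.comp_def] using (tendsto_pow_atTop (α := ℝ) two_ne_zero).comp tendsto_abs_atBot_atTop
  have := (tendsto_neg_atTop_atBot.comp h).atBot_div_const (r := 2) (by norm_num)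
  exact this

lemma stdPDF_le_of_abs_le {x y : ℝ} (h : |x| ≤ |y|) : stdPDF y ≤ stdPDF x := by
  rw [stdPDF_eq, stdPDF_eq]
  have := sq_le_sq.2 h
  gcongr

lemma stdCDF_eq_integral (x : ℝ) : stdCDF x = ∫ t in Iic x, stdPDF t := by
  rw [stdCDF, cdf_eq_real, measureReal_def, gaussianReal_apply_eq_integral 0 one_ne_zero,
    ENNReal.toReal_ofReal]
  · rfl
  · exact integral_nonneg fun t => gaussianPDFReal_nonneg 0 1 t

lemma integrable_stdPDF : Integrable stdPDF := integrable_gaussianPDFReal 0 1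

lemma hasDerivAt_stdCDF (x : ℝ) : HasDerivAt stdCDF (stdPDF x) x := by
  have h : stdCDF = fun y => stdCDF 0 + ∫ t in (0 : ℝ)..y, stdPDF t := by
    funext y
    rw [stdCDF_eq_integral, stdCDF_eq_integral,
      ← intervalIntegral.integral_Iic_sub_Iic integrable_stdPDF.integrableOn
        integrable_stdPDF.integrableOn]
    ring
  rw [h]
  exact (continuous_stdPDF.integral_hasStrictDerivAt 0 x).hasDerivAt.const_add _

lemma stdCDF_nonneg (x : ℝ) : 0 ≤ stdCDF x := cdf_nonneg _ _

lemma stdCDF_le_one (x : ℝ) : stdCDF x ≤ 1 := cdf_le_one _ _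

lemma monotone_stdCDF : Monotone stdCDF := monotone_cdf _

lemma continuous_stdCDF : Continuous stdCDF :=
  continuous_iff_continuousAt.2 fun x => (hasDerivAt_stdCDF x).continuousAt

lemma stdCDF_neg (x : ℝ) : stdCDF (-x) = 1 - stdCDF x := by
  have h1 : stdCDF (-x) = ∫ t in Ioi x, stdPDF t := by
    rw [stdCDF_eq_integral, ← integral_comp_neg_Ioi]
    simp [stdPDF_neg]
  have h2 : (∫ t in Iic x, stdPDF t) + ∫ t in Ioi x, stdPDF t = 1 := by
    have := integral_add_compl (μ := volume) (measurableSet_Iic (a := x)) integrable_stdPDF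
    rw [compl_Iic] at this
    rw [this]
    exact integral_gaussianPDFReal_eq_one 0 one_ne_zero
  rw [h1, stdCDF_eq_integral x]
  linarith

/-- Mills' inequality for the lower tail. -/
lemma neg_mul_stdCDF_le {x : ℝ} (hx : x < 0) : -x * stdCDF x ≤ stdPDF x := by
  -- `h` vanishes at `-∞` and its derivative `φ(y) / y ^ 2` is nonnegative.
  set h : ℝ → ℝ := fun y => -(stdPDF y / y) - stdCDF y with hh
  have hd : ∀ y < 0, HasDerivAt h (stdPDF y / y ^ 2) y := by
    intro y hy
    convert! (((hasDerivAt_stdPDF y).div (hasDerivAt_id y) hy.ne).neg).sub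
      (hasDerivAt_stdCDF y) using 1
    have := hy.ne
    simp only [id]
    field_simp
    ring
  have hmono : MonotoneOn h (Iio 0) := by
    refine monotoneOn_of_deriv_nonneg (convex_Iio 0)
      (fun y hy => (hd y hy).continuousAt.continuousWithinAt)
      (fun y hy => ?_) (fun y hy => ?_)
    · exact (hd y (interior_subset (s := Iio (0 : ℝ)) hy)).differentiableAt.differentiableWithinAt
    · rw [(hd y (interior_subset (s := Iio (0 : ℝ)) hy)).deriv]
      exact div_nonneg (stdPDF_pos y).le (sq_nonneg y)
  have hlim : Tendsto h atBot (𝓝 0) := by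
    have h1 : Tendsto (fun y => stdPDF y / y) atBot (𝓝 0) := by
      simpa [div_eq_mul_inv] using tendsto_stdPDF_atBot.mul tendsto_inv_atBot_zero
    have h2 := h1.neg.sub (tendsto_cdf_atBot (gaussianReal 0 1))
    rwa [neg_zero, sub_zero] at h2
  have h0 : 0 ≤ h x := by
    refine le_of_tendsto hlim ?_
    filter_upwards [eventually_le_atBot x] with y hy
    exact hmono (lt_of_le_of_lt hy hx) hx hy
  have h3 : stdCDF x ≤ stdPDF x / -x := by
    rw [div_neg]
    simp only [hh] at h0
    linarith
  rw [le_div_iff₀ (by linarith)] at h3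
  linarith

/-- The lower-tail Mills ratio `Φ / φ`. -/
def mills (x : ℝ) : ℝ := stdCDF x / stdPDF x

lemma mills_nonneg (x : ℝ) : 0 ≤ mills x := div_nonneg (stdCDF_nonneg x) (stdPDF_pos x).le

lemma hasDerivAt_mills (x : ℝ) : HasDerivAt mills (x * mills x + 1) x := by
  have := (hasDerivAt_stdCDF x).div (hasDerivAt_stdPDF x) (stdPDF_pos x).ne'
  convert! this using 1
  have := (stdPDF_pos x).ne'
  rw [mills]
  field_simp
  ring

lemma abs_mul_mills_le {x : ℝ} (hx : x ≤ 0) : |x| * mills x ≤ 1 := by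
  rcases hx.lt_or_eq with h | rfl
  · rw [abs_of_neg h, mills, ← mul_div_assoc, div_le_one (stdPDF_pos x)]
    exact neg_mul_stdCDF_le h
  · simp

/-- A (non-optimal) bound for the Mills ratio on the negative half-line. -/
def millsBound : ℝ := 1 + (stdPDF 1)⁻¹

lemma millsBound_pos : 0 < millsBound := by
  have := stdPDF_pos 1
  rw [millsBound]; positivity

lemma mills_le {x : ℝ} (hx : x ≤ 0) : mills x ≤ millsBound := by
  have h1 : 0 < (stdPDF 1)⁻¹ := inv_pos.2 (stdPDF_pos 1)
  rcases le_total x (-1) with h | h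
  · have h2 := abs_mul_mills_le hx
    have h3 : 1 ≤ |x| := by rw [abs_of_nonpos hx]; linarith
    have h4 := mills_nonneg x
    rw [millsBound]
    nlinarith
  · have h2 : stdPDF 1 ≤ stdPDF x := stdPDF_le_of_abs_le (by
      rw [abs_of_nonpos hx, abs_one]; linarith)
    have h3 : mills x ≤ (stdPDF 1)⁻¹ := by
      rw [mills, ← one_div]
      exact div_le_div₀ zero_le_one (stdCDF_le_one x) (stdPDF_pos 1) h2
    rw [millsBound]; linarith

/-- For `w ≤ z` the product `(1 - Φ(z)) Φ(w) / φ(w)` is at most the Mills ratio at `-|w|`. -/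
lemma stein_left_le {w z : ℝ} (h : w ≤ z) : stdCDF (-z) * mills w ≤ mills (-|w|) := by
  rcases le_total w 0 with hw | hw
  · rw [abs_of_nonpos hw, neg_neg]
    exact mul_le_of_le_one_left (mills_nonneg w) (stdCDF_le_one _)
  · rw [abs_of_nonneg hw, mills, mills, stdPDF_neg, ← mul_div_assoc]
    have h1 : stdCDF (-z) ≤ stdCDF (-w) := monotone_stdCDF (by linarith)
    have h2 : stdCDF (-z) * stdCDF w ≤ stdCDF (-w) := by
      nlinarith [stdCDF_nonneg (-z), stdCDF_le_one w, stdCDF_nonneg w]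
    exact div_le_div_of_nonneg_right h2 (stdPDF_pos w).le

/-- The bounded solution `f` of Stein's equation `f'(w) - w f(w) = 1_{w ≤ z} - Φ(z)`. -/
def stein (z w : ℝ) : ℝ :=
  if w ≤ z then stdCDF (-z) * mills w else stdCDF z * mills (-w)

lemma stein_of_le {z w : ℝ} (h : w ≤ z) : stein z w = stdCDF (-z) * mills w := if_pos h

lemma stein_of_ge {z w : ℝ} (h : z ≤ w) : stein z w = stdCDF z * mills (-w) := by
  rcases h.lt_or_eq with h | rfl
  · exact if_neg h.not_ge
  · rw [stein_of_le le_rfl, mills, mills, stdPDF_neg]; ring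

/-- The increment estimate for one smooth branch of the Stein solution: a solution of
`f'(w) = w f(w) + c` with the bounds that hold for the Stein solution. -/
lemma stein_increment_aux {f : ℝ → ℝ} {a b c R y : ℝ} (hab : a ≤ b) (hc : |c| ≤ 1)
    (hR : ∀ w ∈ Icc a b, |w| ≤ R)
    (hf : ∀ w ∈ Icc a b, HasDerivAt f (w * f w + c) w)
    (hb : ∀ w ∈ Icc a b, |f w| ≤ millsBound) (hwb : ∀ w ∈ Icc a b, |w| * |f w| ≤ 1)
    (hy : y ∈ Icc a b) :
    |f b - f a - (b - a) * (y * f y + c)| ≤ (b - a) ^ 2 * (millsBound + 2 * R) := by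
  rcases hab.lt_or_eq with hlt | rfl
  swap
  · simp
  have hG : ∀ w ∈ Icc a b, HasDerivAt (fun w => w * f w) (1 * f w + w * (w * f w + c)) w :=
    fun w hw => (hasDerivAt_id w).mul (hf w hw)
  have hG' : ∀ w ∈ Icc a b, ‖1 * f w + w * (w * f w + c)‖ ≤ millsBound + 2 * R := by
    intro w hw
    have h1 := hb w hw
    have h2 : |w * f w + c| ≤ 2 := by
      refine (abs_add_le _ _).trans ?_
      rw [abs_mul]
      linarith [hwb w hw]
    rw [Real.norm_eq_abs]
    refine (abs_add_le _ _).trans ?_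
    rw [one_mul, abs_mul]
    have h3 : |w| * |w * f w + c| ≤ R * 2 :=
      mul_le_mul (hR w hw) h2 (abs_nonneg _) ((abs_nonneg _).trans (hR w hw))
    linarith
  obtain ⟨ξ, hξ, hξe⟩ := exists_hasDerivAt_eq_slope f (fun w => w * f w + c) hlt
    (fun w hw => (hf w hw).continuousAt.continuousWithinAt)
    (fun w hw => hf w (Ioo_subset_Icc_self hw))
  have hξ' := Ioo_subset_Icc_self hξ
  have h1 : f b - f a = (b - a) * (ξ * f ξ + c) := by
    rw [hξe]; field_simp [(sub_pos.2 hlt).ne']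
  have h2 := (convex_Icc a b).norm_image_sub_le_of_norm_hasDerivWithin_le
    (fun w hw => (hG w hw).hasDerivWithinAt) hG' hy hξ'
  have h3 : |ξ - y| ≤ b - a := by
    rw [abs_le]; constructor <;> linarith [hy.1, hy.2, hξ'.1, hξ'.2]
  rw [h1, show (b - a) * (ξ * f ξ + c) - (b - a) * (y * f y + c)
    = (b - a) * (ξ * f ξ - y * f y) by ring, abs_mul, abs_of_pos (sub_pos.2 hlt), sq, mul_assoc]
  refine mul_le_mul_of_nonneg_left ?_ (sub_pos.2 hlt).le
  rw [Real.norm_eq_abs, Real.norm_eq_abs] at h2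
  have h4 : 0 ≤ millsBound + 2 * R := (norm_nonneg _).trans (hG' y hy)
  calc _ ≤ _ := h2
    _ ≤ (millsBound + 2 * R) * (b - a) := mul_le_mul_of_nonneg_left h3 h4
    _ = _ := mul_comm _ _

/-- On an interval `[a, b]` whose interior avoids `z`, the increment of the Stein solution is
`(b - a) (y f(y) + 1_{b ≤ z} - Φ(z))`, for any `y` in the interval, up to an error quadratic in
`b - a`. -/
lemma stein_increment {z a b R y : ℝ} (hab : a ≤ b) (hz : b ≤ z ∨ z ≤ a)
    (hR : ∀ w ∈ Icc a b, |w| ≤ R) (hy : y ∈ Icc a b) :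
    |stein z b - stein z a -
        (b - a) * (y * stein z y + ((if b ≤ z then 1 else 0) - stdCDF z))| ≤
      (b - a) ^ 2 * (millsBound + 2 * R) := by
  rcases hab.lt_or_eq with hlt | rfl
  swap
  · simp
  have hneg : ∀ w : ℝ, -|w| ≤ 0 := fun w => neg_nonpos.2 (abs_nonneg w)
  rcases hz with hz | hz
  · have hle : ∀ w ∈ Icc a b, w ≤ z := fun w hw => hw.2.trans hz
    rw [if_pos hz, stein_of_le hz, stein_of_le (hab.trans hz), stein_of_le (hle y hy),
      ← stdCDF_neg]
    have habs : ∀ w, |stdCDF (-z) * mills w| = stdCDF (-z) * mills w := fun w =>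
      abs_of_nonneg (mul_nonneg (stdCDF_nonneg _) (mills_nonneg w))
    refine stein_increment_aux (f := fun w => stdCDF (-z) * mills w) hab ?_ hR ?_ ?_ ?_ hy
    · rw [abs_of_nonneg (stdCDF_nonneg _)]; exact stdCDF_le_one _
    · intro w _
      convert! (hasDerivAt_mills w).const_mul (stdCDF (-z)) using 1
      ring
    · intro w hw
      rw [habs]
      exact (stein_left_le (hle w hw)).trans (mills_le (hneg w))
    · intro w hw
      rw [habs]
      refine (mul_le_mul_of_nonneg_left (stein_left_le (hle w hw)) (abs_nonneg w)).trans ?_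
      simpa using abs_mul_mills_le (hneg w)
  · have hle : ∀ w ∈ Icc a b, -w ≤ -z := fun w hw => neg_le_neg (hz.trans hw.1)
    rw [if_neg (by linarith), stein_of_ge hz, stein_of_ge (hz.trans hab),
      stein_of_ge (hz.trans hy.1), zero_sub]
    have habs : ∀ w, |stdCDF z * mills w| = stdCDF z * mills w := fun w =>
      abs_of_nonneg (mul_nonneg (stdCDF_nonneg _) (mills_nonneg w))
    have hleft : ∀ w ∈ Icc a b, stdCDF z * mills (-w) ≤ mills (-|w|) := by
      intro w hw
      simpa using stein_left_le (hle w hw)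
    refine stein_increment_aux (f := fun w => stdCDF z * mills (-w)) hab ?_ hR ?_ ?_ ?_ hy
    · rw [abs_neg, abs_of_nonneg (stdCDF_nonneg _)]; exact stdCDF_le_one _
    · intro w _
      have h := ((hasDerivAt_mills (-w)).comp w (hasDerivAt_neg w)).const_mul (stdCDF z)
      convert! h using 1
      ring
    · intro w hw
      rw [habs]
      exact (hleft w hw).trans (mills_le (hneg w))
    · intro w hw
      rw [habs]
      refine (mul_le_mul_of_nonneg_left (hleft w hw) (abs_nonneg w)).trans ?_
      simpa using abs_mul_mills_le (hneg w)

end Normal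

/-! ### The binomial law and its normal approximation -/

section Binomial

open Finset

/-- The expectation of `F` under the binomial law with `n` trials and success probability `q`,
defined by recursion on the number of trials. -/
def binExp (q : ℝ) : ℕ → (ℕ → ℝ) → ℝ
  | 0, F => F 0
  | n + 1, F => binExp q n fun k => q * F (k + 1) + (1 - q) * F k

lemma binExp_succ (q : ℝ) (n : ℕ) (F : ℕ → ℝ) :
    binExp q (n + 1) F = binExp q n fun k => q * F (k + 1) + (1 - q) * F k := rfl

lemma binExp_add (q : ℝ) (n : ℕ) (F G : ℕ → ℝ) :
    binExp q n (fun k => F k + G k) = binExp q n F + binExp q n G := by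
  induction n generalizing F G with
  | zero => rfl
  | succ n ih =>
    simp only [binExp_succ, ← ih]
    congr 1; funext k; ring

lemma binExp_const_mul (q c : ℝ) (n : ℕ) (F : ℕ → ℝ) :
    binExp q n (fun k => c * F k) = c * binExp q n F := by
  induction n generalizing F with
  | zero => rfl
  | succ n ih =>
    simp only [binExp_succ, ← ih]
    congr 1; funext k; ring

lemma binExp_sub (q : ℝ) (n : ℕ) (F G : ℕ → ℝ) :
    binExp q n (fun k => F k - G k) = binExp q n F - binExp q n G := by
  have := binExp_add q n F fun k => -1 * G k
  rw [binExp_const_mul] at this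
  rw [sub_eq_add_neg, ← neg_one_mul, ← this]
  congr 1; funext k; ring

lemma binExp_const (q c : ℝ) (n : ℕ) : binExp q n (fun _ => c) = c := by
  induction n with
  | zero => rfl
  | succ n ih =>
    rw [binExp_succ, show (fun _ : ℕ => q * c + (1 - q) * c) = fun _ => c by funext; ring, ih]

lemma binExp_mono {q : ℝ} (hq0 : 0 ≤ q) (hq1 : q ≤ 1) {n : ℕ} {F G : ℕ → ℝ}
    (h : ∀ k ≤ n, F k ≤ G k) : binExp q n F ≤ binExp q n G := by
  induction n generalizing F G with
  | zero => exact h 0 le_rfl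
  | succ n ih =>
    refine ih fun k hk => add_le_add ?_ ?_
    · exact mul_le_mul_of_nonneg_left (h _ (by omega)) hq0
    · exact mul_le_mul_of_nonneg_left (h _ (by omega)) (by linarith)

lemma abs_binExp_le {q : ℝ} (hq0 : 0 ≤ q) (hq1 : q ≤ 1) {n : ℕ} {F G : ℕ → ℝ}
    (h : ∀ k ≤ n, |F k| ≤ G k) : |binExp q n F| ≤ binExp q n G := by
  rw [abs_le]
  constructor
  · have := binExp_mono hq0 hq1 (F := fun k => -1 * G k) (G := F) (n := n) fun k hk => by
      have := (abs_le.1 (h k hk)).1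
      linarith
    rw [binExp_const_mul] at this
    linarith
  · exact binExp_mono hq0 hq1 fun k hk => (abs_le.1 (h k hk)).2

/-- The binomial law as the law of the size of a random subset, each element of `s` being included
independently with probability `q`. -/
lemma sum_powerset_eq_binExp {α : Type*} [DecidableEq α] (q : ℝ) (s : Finset α) (F : ℕ → ℝ) :
    ∑ t ∈ s.powerset, q ^ #t * (1 - q) ^ (#s - #t) * F #t = binExp q #s F := by
  induction s using Finset.induction_on generalizing F with
  | empty => simp [binExp]
  | insert a s ha ih =>
    rw [sum_powerset_insert ha, card_insert_of_notMem ha, binExp_succ, ← ih, ← sum_add_distrib]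
    refine sum_congr rfl fun t ht => ?_
    have hts := mem_powerset.1 ht
    rw [card_insert_of_notMem fun h => ha (hts h), Nat.succ_sub (card_le_card hts)]
    rw [Nat.add_sub_add_right, pow_succ, pow_succ]
    ring

/-- The zero-bias (Stein) identity of the binomial law. -/
lemma binExp_stein (q : ℝ) (n : ℕ) (F : ℕ → ℝ) :
    binExp q (n + 1) (fun k => ((k : ℝ) - (n + 1) * q) * F k) =
      (n + 1) * q * (1 - q) * binExp q n (fun k => F (k + 1) - F k) := by
  induction n generalizing F with
  | zero => simp [binExp]; ring
  | succ n ih =>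
    have h : (fun k : ℕ => q * ((((k + 1 : ℕ) : ℝ) - ((n + 1 : ℕ) + 1) * q) * F (k + 1)) +
        (1 - q) * (((k : ℝ) - ((n + 1 : ℕ) + 1) * q) * F k)) =
        fun k : ℕ => ((k : ℝ) - (n + 1) * q) * (q * F (k + 1) + (1 - q) * F k) +
          q * (1 - q) * (F (k + 1) - F k) := by
      funext k; push_cast; ring
    rw [binExp_succ, h, binExp_add, ih fun k => q * F (k + 1) + (1 - q) * F k, binExp_const_mul]
    have h2 : binExp q n (fun k => q * F (k + 1 + 1) + (1 - q) * F (k + 1) -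
        (q * F (k + 1) + (1 - q) * F k)) = binExp q (n + 1) (fun k => F (k + 1) - F k) := by
      rw [binExp_succ]; congr 1; funext k; ring
    rw [h2]
    push_cast; ring

lemma binExp_variance (q : ℝ) (n : ℕ) :
    binExp q n (fun k => ((k : ℝ) - n * q) ^ 2) = n * q * (1 - q) := by
  cases n with
  | zero => simp [binExp]
  | succ n =>
    have := binExp_stein q n fun k => (k : ℝ) - (n + 1) * q
    simp only [Nat.cast_add, Nat.cast_one, sub_sub_sub_cancel_right,
      add_sub_cancel_left, binExp_const] at this ⊢
    rw [mul_one] at this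
    rw [← this]
    congr 1; funext k; ring

/-- The mean absolute deviation is at most the standard deviation, from
`|x| ≤ x ^ 2 / (2 σ) + σ / 2`. -/
lemma binExp_abs_le {q σ : ℝ} (hq0 : 0 ≤ q) (hq1 : q ≤ 1) {n : ℕ} (hσ : 0 < σ)
    (h : n * q * (1 - q) ≤ σ ^ 2) : binExp q n (fun k => |(k : ℝ) - n * q|) ≤ σ := by
  have h1 : binExp q n (fun k => |(k : ℝ) - n * q|) ≤
      binExp q n (fun k => (2 * σ)⁻¹ * ((k : ℝ) - n * q) ^ 2 + σ / 2) := by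
    refine binExp_mono hq0 hq1 fun k _ => ?_
    have h2 := sq_nonneg (|(k : ℝ) - n * q| - σ)
    rw [sub_sq, sq_abs] at h2
    rw [inv_mul_eq_div, div_add_div _ _ (by positivity) two_ne_zero, le_div_iff₀ (by positivity)]
    nlinarith
  rw [binExp_add, binExp_const_mul, binExp_variance, binExp_const] at h1
  refine h1.trans ?_
  have : (2 * σ)⁻¹ * (n * q * (1 - q)) ≤ (2 * σ)⁻¹ * σ ^ 2 := by gcongr
  have h3 : (2 * σ)⁻¹ * σ ^ 2 = σ / 2 := by field_simp
  linarith

/-- The probability that a binomial variable is less than `j`. -/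
def binLT (q : ℝ) (n j : ℕ) : ℝ := binExp q n fun k => if k < j then 1 else 0

/-- A Berry–Esseen bound for the binomial law. The centring and scaling are those of `n + 1`
trials, because the zero-bias distribution of `n + 1` trials is the law of `n` trials up to a
smoothing on the scale of one trial. -/
lemma binLT_sub_stdCDF_le {q : ℝ} (hq0 : 0 < q) (hq1 : q < 1) :
    ∃ C : ℝ, 0 < C ∧ ∀ n j : ℕ,
      |binLT q n j - stdCDF (((j : ℝ) - (n + 1) * q) / √((n + 1) * q * (1 - q)))| ≤
        C / √(n + 1) := by
  have hp : 0 < 1 - q := by linarith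
  have hmB := millsBound_pos
  set c0 : ℝ := (√(q * (1 - q)))⁻¹ with hc0
  have hc0pos : 0 < c0 := by positivity
  refine ⟨c0 * (millsBound + 2 + 4 * c0), by positivity, fun n j => ?_⟩
  have hN : (1 : ℝ) ≤ (n : ℝ) + 1 := by linarith [n.cast_nonneg (α := ℝ)]
  set σ : ℝ := √((n + 1) * q * (1 - q)) with hσ
  have hσpos : 0 < σ := by positivity
  have hσ2 : σ ^ 2 = (n + 1) * q * (1 - q) := Real.sq_sqrt (by positivity)
  set h : ℝ := σ⁻¹ with hh
  have hpos : 0 < h := by positivity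
  have hσh : σ * h = 1 := mul_inv_cancel₀ hσpos.ne'
  have hheq : h = c0 / √(n + 1) := by
    rw [hh, hσ, hc0, mul_assoc, Real.sqrt_mul (by positivity), mul_inv, div_eq_mul_inv, mul_comm]
  have hle : h ≤ c0 := by
    rw [hheq]
    exact div_le_self hc0pos.le (Real.one_le_sqrt.2 hN)
  set w : ℕ → ℝ := fun k => ((k : ℝ) - (n + 1) * q) / σ with hw
  set z : ℝ := w j with hz
  have hwmono : ∀ {k l : ℕ}, w k ≤ w l ↔ k ≤ l := by
    intro k l
    simp only [hw]
    rw [div_le_div_iff_of_pos_right hσpos, sub_le_sub_iff_right, Nat.cast_le]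
  have hstep : ∀ k, w (k + 1) - w k = h := by
    intro k
    simp only [hw, hh]
    push_cast
    field_simp
    ring
  have hmean : binExp q n (fun k => |w k|) ≤ 1 + h := by
    have h1 : binExp q n (fun k => |w k|) ≤ binExp q n
        (fun k => h * |(k : ℝ) - n * q| + h) := by
      refine binExp_mono hq0.le hq1.le fun k _ => ?_
      have : |(k : ℝ) - (n + 1) * q| ≤ |(k : ℝ) - n * q| + 1 := by
        have e : (k : ℝ) - (n + 1) * q = ((k : ℝ) - n * q) - q := by ring
        rw [e]
        refine (abs_sub _ _).trans ?_
        rw [abs_of_pos hq0]; linarith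
      simp only [hw]
      rw [abs_div, abs_of_pos hσpos, div_eq_inv_mul]
      nlinarith
    rw [binExp_add, binExp_const_mul, binExp_const] at h1
    have h2 := binExp_abs_le hq0.le hq1.le (n := n) hσpos (by
      rw [hσ2]; gcongr; linarith)
    have : h * binExp q n (fun k => |(k : ℝ) - n * q|) ≤ h * σ := by gcongr
    nlinarith
  set F : ℕ → ℝ := fun k => stein z (w k) with hF
  -- `A` is the summand of `E_{n+1}[W f(W)]` after conditioning on the first `n` trials.
  set A : ℕ → ℝ := fun k => q * (w (k + 1) * F (k + 1)) + (1 - q) * (w k * F k) with hA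
  have hstein : binExp q n A = σ * binExp q n (fun k => F (k + 1) - F k) := by
    have h1 := binExp_stein q n F
    have h2 : (fun k : ℕ => ((k : ℝ) - (n + 1) * q) * F k) = fun k => σ * (w k * F k) := by
      funext k
      simp only [hw]
      field_simp
    rw [h2, binExp_const_mul, ← hσ2, sq, mul_assoc] at h1
    exact mul_left_cancel₀ hσpos.ne' h1
  set c : ℕ → ℝ := fun k => (if k < j then (1 : ℝ) else 0) - stdCDF z with hc
  have hbound : ∀ k ≤ n, |(F (k + 1) - F k) - h * A k - h * c k| ≤
      h ^ 2 * (millsBound + 2 * h) + 2 * h ^ 2 * |w k| := by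
    intro k _
    have hab : w k ≤ w (k + 1) := hwmono.2 k.le_succ
    have hzz : w (k + 1) ≤ z ∨ z ≤ w k := by
      rcases Nat.lt_or_ge k j with h1 | h1
      · exact Or.inl (hwmono.2 h1)
      · exact Or.inr (hwmono.2 h1)
    have hR : ∀ y ∈ Set.Icc (w k) (w (k + 1)), |y| ≤ |w k| + h := by
      intro y hy
      have : |y - w k| ≤ h := by
        rw [abs_of_nonneg (by linarith [hy.1]), ← hstep k]
        linarith [hy.2]
      have h3 := abs_add_le (w k) (y - w k)
      rw [add_sub_cancel] at h3
      linarith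
    -- The estimate at both endpoints, averaged with weights `q` and `1 - q` to match `A`.
    have e1 := stein_increment hab hzz hR (Set.right_mem_Icc.2 hab)
    have e2 := stein_increment hab hzz hR (Set.left_mem_Icc.2 hab)
    have hif : (if w (k + 1) ≤ z then (1 : ℝ) else 0) = if k < j then 1 else 0 :=
      if_congr (hwmono.trans Nat.succ_le_iff) rfl rfl
    rw [hif, hstep] at e1 e2
    have e3 : (F (k + 1) - F k) - h * A k - h * c k =
        q * (F (k + 1) - F k - h * (w (k + 1) * F (k + 1) + c k)) +
        (1 - q) * (F (k + 1) - F k - h * (w k * F k + c k)) := by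
      simp only [hA]; ring
    rw [e3]
    refine (abs_add_le _ _).trans ?_
    rw [abs_mul, abs_mul, abs_of_pos hq0, abs_of_pos hp]
    have f1 := mul_le_mul_of_nonneg_left e1 hq0.le
    have f2 := mul_le_mul_of_nonneg_left e2 hp.le
    refine (add_le_add f1 f2).trans (le_of_eq ?_)
    ring
  have hmain := abs_binExp_le hq0.le hq1.le hbound
  rw [binExp_sub, binExp_sub, binExp_const_mul, binExp_const_mul, hstein, ← mul_assoc,
    mul_comm h σ, hσh, one_mul, sub_self, zero_sub, abs_neg, abs_mul, abs_of_pos hpos, binExp_add,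
    binExp_const, binExp_const_mul] at hmain
  have hEc : binExp q n c = binLT q n j - stdCDF z := by
    rw [hc, binExp_sub, binExp_const]; rfl
  rw [hEc] at hmain
  have h4 : h * |binLT q n j - stdCDF z| ≤ h * (h * (millsBound + 2 + 4 * c0)) := by
    refine hmain.trans ?_
    have : 2 * h ^ 2 * binExp q n (fun k => |w k|) ≤ 2 * h ^ 2 * (1 + h) := by gcongr
    have h5 : h ^ 2 * h ≤ h ^ 2 * c0 := by gcongr
    nlinarith
  have h5 := le_of_mul_le_mul_left h4 hpos
  refine h5.trans (le_of_eq ?_)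
  rw [hheq]; ring

end Binomial

/-! ### Channels, and the converse bound for the erasure channel -/

section Converse

open Finset Matrix

section Channels
variable {A B : Type*}

lemma IsCompletelyPositive.posSemidef {Φ : Matrix A A ℂ →ₗ[ℂ] Matrix B B ℂ}
    (hΦ : IsCompletelyPositive Φ) {X : Matrix A A ℂ} (hX : X.PosSemidef) :
    (Φ X).PosSemidef :=
  (hΦ 1 (X.submatrix Prod.snd Prod.snd) (hX.submatrix _)).submatrix fun b => (0, b)

/-- A positive semidefinite matrix of trace one is at most the identity. -/
lemma posSemidef_one_sub [Fintype A] [DecidableEq A] {X : Matrix A A ℂ} (hX : X.PosSemidef)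
    (htr : X.trace = 1) : (1 - X).PosSemidef := by
  have hH := hX.isHermitian
  have hle : ∀ i, hH.eigenvalues i ≤ 1 := by
    intro i
    have h1 := hH.trace_eq_sum_eigenvalues
    rw [htr] at h1
    have h2 : (1 : ℝ) = ∑ i, hH.eigenvalues i := by
      have := congrArg Complex.re h1
      simpa using this
    rw [h2]
    exact single_le_sum (f := hH.eigenvalues) (fun j _ => hX.eigenvalues_nonneg j) (mem_univ i)
  have h3 : 1 - X = (hH.eigenvectorUnitary : Matrix A A ℂ) *
      diagonal (fun i => ((1 - hH.eigenvalues i : ℝ) : ℂ)) *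
      (hH.eigenvectorUnitary : Matrix A A ℂ)ᴴ := by
    have h4 : diagonal (fun i => ((1 - hH.eigenvalues i : ℝ) : ℂ)) =
        1 - diagonal (RCLike.ofReal ∘ hH.eigenvalues) := by
      rw [← diagonal_one, diagonal_sub]
      congr 1; funext i; simp
    have h5 := hH.spectral_theorem
    rw [Unitary.conjStarAlgAut_apply] at h5
    rw [h4, mul_sub, sub_mul, mul_one]
    conv_lhs => rw [h5]
    congr 1
    exact (Unitary.coe_mul_star_self hH.eigenvectorUnitary).symm
  rw [h3]
  refine PosSemidef.mul_mul_conjTranspose_same ?_ _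
  rw [posSemidef_diagonal_iff]
  intro i
  exact_mod_cast sub_nonneg.2 (hle i)

lemma trace_mul_single_self [Fintype A] [DecidableEq A] (X : Matrix A A ℂ) (k : A) :
    (X * single k k 1).trace = X k k := by
  rw [trace_mul_single]; simp

variable [Fintype A] [DecidableEq B]

/-- The channel that measures in the standard basis and applies the function `g` to the outcome. -/
def classicalChannel (g : A → B) : Matrix A A ℂ →ₗ[ℂ] Matrix B B ℂ where
  toFun X := diagonal fun y => ∑ a, if g a = y then X a a else 0
  map_add' X Y := by
    rw [diagonal_add]
    congr 1; funext y
    rw [← sum_add_distrib]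
    refine sum_congr rfl fun a _ => ?_
    split_ifs <;> simp
  map_smul' c X := by
    rw [RingHom.id_apply, ← diagonal_smul]
    congr 1; funext y
    simp [mul_sum]

lemma classicalChannel_apply_self (g : A → B) (X : Matrix A A ℂ) (y : B) :
    classicalChannel g X y y = ∑ a, if g a = y then X a a else 0 := by
  simp [classicalChannel]

lemma classicalChannel_single [DecidableEq A] (g : A → B) (a : A) :
    classicalChannel g (single a a 1) = single (g a) (g a) 1 := by
  ext y y'
  simp only [classicalChannel, LinearMap.coe_mk, AddHom.coe_mk, diagonal_apply, single_apply]
  by_cases h : y = y'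
  · subst h
    simp only [if_true, and_self]
    rw [sum_eq_single a]
    · simp
    · intro b _ hb; simp [hb.symm]
    · simp
  · rw [if_neg h, if_neg]
    rintro ⟨rfl, rfl⟩; exact h rfl

lemma isChannel_classicalChannel [Fintype B] (g : A → B) : IsChannel (classicalChannel g) := by
  classical
  constructor
  · intro k X hX
    have h : ampliation k (classicalChannel g) X =
        ∑ a, diagonal (fun y : Fin k × B => if g a = y.2 then (1 : ℂ) else 0) *
          X.submatrix (fun y : Fin k × B => (y.1, a)) (fun y : Fin k × B => (y.1, a)) *
          (diagonal (fun y : Fin k × B => if g a = y.2 then (1 : ℂ) else 0))ᴴ := by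
      ext y y'
      rw [Matrix.sum_apply]
      simp only [diagonal_conjTranspose, mul_diagonal, diagonal_mul, submatrix_apply, ampliation, of_apply,
        classicalChannel, LinearMap.coe_mk, AddHom.coe_mk, diagonal_apply, Pi.star_apply,
        apply_ite (star : ℂ → ℂ), star_one, star_zero]
      split_ifs with h
      · refine sum_congr rfl fun a _ => ?_
        rw [← h]
        split_ifs <;> simp
      · refine (sum_eq_zero fun a _ => ?_).symm
        by_cases h1 : g a = y.2
        · rw [if_neg (c := g a = y'.2) (fun h2 => h (h1.symm.trans h2)), mul_zero]
        · rw [if_neg h1, zero_mul, zero_mul]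
    rw [h]
    exact posSemidef_sum _ fun a _ => (hX.submatrix _).mul_mul_conjTranspose_same _
  · intro X
    simp only [trace, diag_apply, classicalChannel_apply_self]
    rw [sum_comm]
    simp

end Channels

section Erasure
variable {d n : ℕ}

/-- The `(b, b')` entry of the output of one site on input `|a⟩⟨a'|`, given whether the site is kept
or erased. -/
def siteEntry (keep : Prop) [Decidable keep] (a a' : Fin d) (b b' : Fin d ⊕ Unit) : ℂ :=
  if keep then (if b = Sum.inl a ∧ b' = Sum.inl a' then 1 else 0)
  else if b = Sum.inr () ∧ b' = Sum.inr () ∧ a = a' then 1 else 0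

lemma erasureChannel_single (p : ℝ) (a a' : Fin d) (b b' : Fin d ⊕ Unit) :
    erasureChannel d p (single a a' 1) b b' =
      (1 - (p : ℂ)) * siteEntry True a a' b b' + p * siteEntry False a a' b b' := by
  rcases b with b | b <;> rcases b' with b' | b' <;>
    simp [erasureChannel, siteEntry, single_apply, eq_comm]
  by_cases h : a = a'
  · subst h; simp
  · simp [h, trace_single_eq_of_ne]

/-- The output of the `n`-fold erasure channel conditional on the set `t` of kept sites. -/
def keptOutput (t : Finset (Fin n)) (X : Matrix (Fin n → Fin d) (Fin n → Fin d) ℂ) :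
    Matrix (Fin n → Fin d ⊕ Unit) (Fin n → Fin d ⊕ Unit) ℂ :=
  of fun b b' => ∑ a, ∑ a', X a a' * ∏ i, siteEntry (i ∈ t) (a i) (a' i) (b i) (b' i)

/-- The probability that exactly the sites in `t` are kept. -/
def keptWeight (p : ℝ) (t : Finset (Fin n)) : ℝ := (1 - p) ^ #t * (1 - (1 - p)) ^ (n - #t)

lemma keptWeight_nonneg {p : ℝ} (hp0 : 0 ≤ p) (hp1 : p ≤ 1) (t : Finset (Fin n)) :
    0 ≤ keptWeight p t :=
  mul_nonneg (pow_nonneg (by linarith) _) (pow_nonneg (by linarith) _)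

lemma sum_keptWeight (p : ℝ) (F : ℕ → ℝ) :
    ∑ t : Finset (Fin n), keptWeight p t * F #t = binExp (1 - p) n F := by
  have := sum_powerset_eq_binExp (1 - p) (univ : Finset (Fin n)) F
  rw [card_univ, Fintype.card_fin, powerset_univ] at this
  exact this

/-- The `n`-fold erasure channel is a mixture over the set of kept sites. -/
lemma tensorPower_erasureChannel (p : ℝ) (X : Matrix (Fin n → Fin d) (Fin n → Fin d) ℂ) :
    tensorPower (erasureChannel d p) n X =
      ∑ t : Finset (Fin n), (keptWeight p t : ℂ) • keptOutput t X := by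
  ext b b'
  rw [Matrix.sum_apply]
  simp only [tensorPower, LinearMap.coe_mk, AddHom.coe_mk, of_apply, Matrix.smul_apply, keptOutput,
    smul_eq_mul, mul_sum]
  conv_rhs => rw [sum_comm]
  refine sum_congr rfl fun a _ => ?_
  conv_rhs => rw [sum_comm]
  refine sum_congr rfl fun a' _ => ?_
  simp only [erasureChannel_single]
  rw [prod_add, powerset_univ, mul_sum]
  refine sum_congr rfl fun t _ => ?_
  have h1 : ∏ i ∈ t, ((1 - (p : ℂ)) * siteEntry True (a i) (a' i) (b i) (b' i)) =
      (1 - (p : ℂ)) ^ #t * ∏ i ∈ t, siteEntry (i ∈ t) (a i) (a' i) (b i) (b' i) := by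
    rw [prod_mul_distrib, prod_const]
    congr 1
    exact prod_congr rfl fun i hi => by simp [siteEntry, hi]
  have h2 : ∏ i ∈ univ \ t, ((p : ℂ) * siteEntry False (a i) (a' i) (b i) (b' i)) =
      (p : ℂ) ^ (n - #t) * ∏ i ∈ univ \ t, siteEntry (i ∈ t) (a i) (a' i) (b i) (b' i) := by
    rw [prod_mul_distrib, prod_const, card_univ_sdiff, Fintype.card_fin]
    congr 1
    exact prod_congr rfl fun i hi => by simp [siteEntry, (mem_sdiff.1 hi).2]
  rw [h1, h2, ← prod_mul_prod_compl t fun i => siteEntry (i ∈ t) (a i) (a' i) (b i) (b' i),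
    compl_eq_univ_sdiff, keptWeight]
  push_cast
  ring

lemma posSemidef_keptOutput (hd : 1 ≤ d) (t : Finset (Fin n))
    {X : Matrix (Fin n → Fin d) (Fin n → Fin d) ℂ} (hX : X.PosSemidef) :
    (keptOutput t X).PosSemidef := by
  -- A Kraus decomposition at each site: `|e⟩⟨c|` for `c : Fin d` at an erased site, and the
  -- isometric embedding at a kept one, where all indices but `c = 0` contribute zero.
  set K : Fin n → Fin d → Fin d ⊕ Unit → Fin d → ℂ := fun i c b a =>
    if i ∈ t then (if c = ⟨0, hd⟩ ∧ b = Sum.inl a then 1 else 0)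
    else if b = Sum.inr () ∧ a = c then 1 else 0 with hK
  have hKstar : ∀ i c b a, star (K i c b a) = K i c b a := by
    intro i c b a
    simp only [hK]
    split_ifs <;> simp
  have hsite : ∀ i a a' b b', siteEntry (i ∈ t) a a' b b' = ∑ c, K i c b a * K i c b' a' := by
    intro i a a' b b'
    simp only [hK, siteEntry]
    by_cases h : i ∈ t
    · simp only [if_pos h]
      rw [sum_eq_single ⟨0, hd⟩]
      · by_cases h1 : b = Sum.inl a <;> by_cases h2 : b' = Sum.inl a' <;> simp [h1, h2]
      · intro c _ hc; simp [hc]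
      · simp
    · simp only [if_neg h]
      rw [sum_eq_single a]
      · by_cases h1 : b = Sum.inr () <;> by_cases h2 : b' = Sum.inr () <;>
          simp [h1, h2, eq_comm]
      · intro c _ hc; simp [hc.symm]
      · simp
  set M : (Fin n → Fin d) → Matrix (Fin n → Fin d ⊕ Unit) (Fin n → Fin d) ℂ :=
    fun κ => of fun b a => ∏ i, K i (κ i) (b i) (a i) with hM
  have h : keptOutput t X = ∑ κ, M κ * X * (M κ)ᴴ := by
    ext b b'
    rw [Matrix.sum_apply]
    simp only [keptOutput, of_apply, mul_apply, conjTranspose_apply, sum_mul]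
    rw [sum_comm]
    symm
    rw [sum_comm]
    refine sum_congr rfl fun a' _ => ?_
    rw [sum_comm]
    refine sum_congr rfl fun a _ => ?_
    simp only [hsite]
    rw [prod_univ_sum, Fintype.piFinset_univ, mul_sum]
    refine sum_congr rfl fun κ _ => ?_
    simp only [hM, of_apply]
    rw [prod_mul_distrib, star_prod]
    simp only [hKstar]
    ring
  rw [h]
  exact posSemidef_sum _ fun κ _ => hX.mul_mul_conjTranspose_same _

lemma trace_keptOutput (t : Finset (Fin n)) (X : Matrix (Fin n → Fin d) (Fin n → Fin d) ℂ) :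
    (keptOutput t X).trace = X.trace := by
  have hsite : ∀ (i : Fin n) (a a' : Fin d),
      ∑ b, siteEntry (i ∈ t) a a' b b = if a = a' then 1 else 0 := by
    intro i a a'
    rw [Fintype.sum_sum_type]
    by_cases h : i ∈ t
    · simp only [siteEntry, if_pos h, Sum.inl.injEq, reduceCtorEq, false_and, if_false,
        sum_const_zero, add_zero]
      by_cases h1 : a = a'
      · subst h1; simp
      · rw [if_neg h1]
        exact sum_eq_zero fun b _ => if_neg fun h2 => h1 (h2.1.symm.trans h2.2)
    · simp [siteEntry, h]
  simp only [trace, diag_apply, keptOutput, of_apply]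
  rw [sum_comm]
  refine sum_congr rfl fun a _ => ?_
  rw [sum_comm, sum_eq_single a]
  · rw [← mul_sum, ← Fintype.piFinset_univ (β := fun _ : Fin n => Fin d ⊕ Unit),
      ← prod_univ_sum (fun _ => univ) fun i b => siteEntry (i ∈ t) (a i) (a i) b b]
    simp [hsite]
  · intro a' _ ha
    rw [← mul_sum, ← Fintype.piFinset_univ (β := fun _ : Fin n => Fin d ⊕ Unit),
      ← prod_univ_sum (fun _ => univ) fun i b => siteEntry (i ∈ t) (a i) (a' i) b b]
    obtain ⟨i, hi⟩ := Function.ne_iff.1 ha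
    rw [prod_eq_zero (mem_univ i), mul_zero]
    rw [hsite, if_neg (Ne.symm hi)]
  · simp

/-- The indicator of the output strings whose set of unerased sites is `t`. -/
def patternInd (t : Finset (Fin n)) (b : Fin n → Fin d ⊕ Unit) : ℂ :=
  ∏ i, if ((b i).isLeft ↔ i ∈ t) then 1 else 0

lemma patternInd_eq (t : Finset (Fin n)) (b : Fin n → Fin d ⊕ Unit) :
    patternInd t b = if ∀ i, ((b i).isLeft ↔ i ∈ t) then 1 else 0 := by
  rw [patternInd]
  split_ifs with h
  · exact prod_eq_one fun i _ => if_pos (h i)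
  · push Not at h
    obtain ⟨i, hi⟩ := h
    exact prod_eq_zero (mem_univ i) (if_neg (by tauto))

lemma keptOutput_support (t : Finset (Fin n)) (X : Matrix (Fin n → Fin d) (Fin n → Fin d) ℂ) :
    diagonal (patternInd t) * keptOutput t X * (diagonal (patternInd t))ᴴ = keptOutput t X := by
  have hsite : ∀ (i : Fin n) (a a' : Fin d) (b b' : Fin d ⊕ Unit),
      ¬ (b.isLeft ↔ i ∈ t) ∨ ¬ (b'.isLeft ↔ i ∈ t) → siteEntry (i ∈ t) a a' b b' = 0 := by
    intro i a a' b b' h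
    by_cases hi : i ∈ t <;> rcases b with b | b <;> rcases b' with b' | b' <;>
      simp_all [siteEntry]
  have hzero : ∀ b b', (¬ ∀ i, ((b i).isLeft ↔ i ∈ t)) ∨ (¬ ∀ i, ((b' i).isLeft ↔ i ∈ t)) →
      keptOutput t X b b' = 0 := by
    intro b b' h
    simp only [keptOutput, of_apply]
    have : ∃ i, ¬ ((b i).isLeft ↔ i ∈ t) ∨ ¬ ((b' i).isLeft ↔ i ∈ t) := by
      rcases h with h | h
      · obtain ⟨i, hi⟩ := not_forall.1 h
        exact ⟨i, Or.inl hi⟩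
      · obtain ⟨i, hi⟩ := not_forall.1 h
        exact ⟨i, Or.inr hi⟩
    obtain ⟨i, hi⟩ := this
    refine sum_eq_zero fun a _ => sum_eq_zero fun a' _ => ?_
    rw [prod_eq_zero (mem_univ i) (hsite i _ _ _ _ hi), mul_zero]
  ext b b'
  rw [diagonal_conjTranspose, mul_diagonal, diagonal_mul, Pi.star_apply, patternInd_eq,
    patternInd_eq]
  by_cases h1 : ∀ i, ((b i).isLeft ↔ i ∈ t)
  · by_cases h2 : ∀ i, ((b' i).isLeft ↔ i ∈ t)
    · rw [if_pos h1, if_pos h2]; simp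
    · rw [hzero b b' (Or.inr h2)]; simp
  · rw [hzero b b' (Or.inl h1)]; simp

lemma trace_diagonal_patternInd (t : Finset (Fin n)) :
    (diagonal (patternInd (d := d) t)).trace = (d : ℂ) ^ #t := by
  have hsite : ∀ i : Fin n, (∑ b : Fin d ⊕ Unit,
      if (b.isLeft ↔ i ∈ t) then (1 : ℂ) else 0) = if i ∈ t then (d : ℂ) else 1 := by
    intro i
    rw [Fintype.sum_sum_type]
    by_cases hi : i ∈ t <;> simp [hi]
  rw [trace_diagonal]
  simp only [patternInd]
  rw [← Fintype.piFinset_univ (β := fun _ : Fin n => Fin d ⊕ Unit),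
    ← prod_univ_sum (fun _ => univ) fun i (b : Fin d ⊕ Unit) =>
      if (b.isLeft ↔ i ∈ t) then (1 : ℂ) else 0]
  simp only [hsite]
  rw [prod_ite_mem, univ_inter, prod_const]

/-- A conditional output state is dominated by the projection onto the strings with the given
erasure pattern, a subspace of dimension `d ^ #t`. -/
lemma posSemidef_patternInd_sub_keptOutput (hd : 1 ≤ d) (t : Finset (Fin n))
    {X : Matrix (Fin n → Fin d) (Fin n → Fin d) ℂ} (hX : X.PosSemidef) (htr : X.trace = 1) :
    (diagonal (patternInd t) - keptOutput t X).PosSemidef := by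
  have h := (posSemidef_one_sub (posSemidef_keptOutput hd t hX)
    ((trace_keptOutput t X).trans htr)).mul_mul_conjTranspose_same (diagonal (patternInd t))
  rw [mul_sub, sub_mul, keptOutput_support, mul_one, diagonal_conjTranspose,
    diagonal_mul_diagonal] at h
  convert! h using 3
  funext b
  rw [Pi.star_apply, patternInd_eq]
  split_ifs <;> simp

/-- The string `x` with the sites outside `t` erased. -/
def erased (t : Finset (Fin n)) (x : Fin n → Fin d) : Fin n → Fin d ⊕ Unit :=
  fun i => if i ∈ t then Sum.inl (x i) else Sum.inr ()

lemma keptOutput_single_self (t : Finset (Fin n)) (x : Fin n → Fin d)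
    (b : Fin n → Fin d ⊕ Unit) :
    keptOutput t (single x x 1) b b = if b = erased t x then 1 else 0 := by
  simp only [keptOutput, of_apply]
  rw [sum_eq_single x, sum_eq_single x]
  · rw [single_apply_same, one_mul]
    have hsite : ∀ i, siteEntry (i ∈ t) (x i) (x i) (b i) (b i) =
        if b i = erased t x i then 1 else 0 := by
      intro i
      by_cases hi : i ∈ t <;> simp [siteEntry, erased, hi]
    simp only [hsite]
    split_ifs with h
    · exact prod_eq_one fun i _ => if_pos (congrFun h i)
    · obtain ⟨i, hi⟩ := Function.ne_iff.1 h
      exact prod_eq_zero (mem_univ i) (if_neg hi)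
  · intro a _ ha
    rw [single_apply_of_ne _ _ _ _ _ (by tauto), zero_mul]
  · simp
  · intro a _ ha
    refine sum_eq_zero fun a' _ => ?_
    rw [single_apply_of_ne _ _ _ _ _ (by tauto), zero_mul]
  · simp

/-- Every code for the erasure channel has success probability at most the expectation of
`min (1, d ^ K / m)`, where `K` is the number of unerased sites. -/
lemma codeSuccess_le (hd : 1 ≤ d) {p : ℝ} (hp0 : 0 ≤ p) (hp1 : p ≤ 1) {m : ℕ} (hm : 1 ≤ m)
    {enc : Matrix (Fin m) (Fin m) ℂ →ₗ[ℂ] Matrix (Fin n → Fin d) (Fin n → Fin d) ℂ}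
    {dec : Matrix (Fin n → Fin d ⊕ Unit) (Fin n → Fin d ⊕ Unit) ℂ →ₗ[ℂ]
      Matrix (Fin m) (Fin m) ℂ} (henc : IsChannel enc) (hdec : IsChannel dec) :
    codeSuccess (tensorPower (erasureChannel d p) n) m enc dec ≤
      binExp (1 - p) n fun k => min 1 ((d : ℝ) ^ k / m) := by
  have hm' : (0 : ℝ) < m := by exact_mod_cast hm
  set ρ : Fin m → Matrix (Fin n → Fin d) (Fin n → Fin d) ℂ := fun k => enc (single k k 1) with hρ
  have hρpos : ∀ k, (ρ k).PosSemidef := by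
    intro k
    refine henc.1.posSemidef ?_
    rw [← diagonal_single, posSemidef_diagonal_iff]
    intro i
    by_cases h : i = k
    · subst h; simp
    · simp [h]
  have hρtr : ∀ k, (ρ k).trace = 1 := fun k => by rw [hρ, henc.2, trace_single_eq_same]
  set g : Finset (Fin n) → Fin m → ℝ := fun t k => (dec (keptOutput t (ρ k)) k k).re with hg
  have hg1 : ∀ t k, g t k ≤ 1 := by
    intro t k
    have hpos := hdec.1.posSemidef (posSemidef_keptOutput hd t (hρpos k))
    have htr : (dec (keptOutput t (ρ k))).trace = 1 := by
      rw [hdec.2, trace_keptOutput, hρtr]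
    have h1 : ∑ i, (dec (keptOutput t (ρ k)) i i).re = 1 := by
      have := congrArg Complex.re htr
      simpa [trace] using this
    rw [← h1]
    exact single_le_sum (f := fun i => (dec (keptOutput t (ρ k)) i i).re)
      (fun i _ => (Complex.le_def.1 (hpos.diag_nonneg (i := i))).1) (mem_univ k)
  have hg2 : ∀ t, ∑ k, g t k ≤ (d : ℝ) ^ #t := by
    intro t
    have h1 : ∑ k, (dec (diagonal (patternInd t)) k k).re = (d : ℝ) ^ #t := by
      have := congrArg Complex.re ((hdec.2 (diagonal (patternInd t))).trans
        (trace_diagonal_patternInd (d := d) t))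
      rw [← Complex.ofReal_natCast, ← Complex.ofReal_pow, Complex.ofReal_re] at this
      simpa [trace] using this
    rw [← h1]
    refine sum_le_sum fun k _ => ?_
    have hpos := (hdec.1.posSemidef
      (posSemidef_patternInd_sub_keptOutput hd t (hρpos k) (hρtr k))).diag_nonneg (i := k)
    rw [map_sub, Matrix.sub_apply] at hpos
    have := (Complex.le_def.1 hpos).1
    rw [Complex.zero_re, Complex.sub_re] at this
    simp only [hg]; linarith
  have hexp : codeSuccess (tensorPower (erasureChannel d p) n) m enc dec =
      ∑ t : Finset (Fin n), keptWeight p t * ((∑ k, g t k) / m) := by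
    simp only [codeSuccess, trace_mul_single_self, tensorPower_erasureChannel, map_sum, map_smul,
      Matrix.sum_apply, Matrix.smul_apply, Complex.re_sum, smul_eq_mul, Complex.re_ofReal_mul]
    rw [sum_comm, mul_sum]
    refine sum_congr rfl fun t _ => ?_
    rw [← mul_sum]
    ring
  rw [hexp, ← sum_keptWeight (n := n) p fun k => min 1 ((d : ℝ) ^ k / m)]
  refine sum_le_sum fun t _ => mul_le_mul_of_nonneg_left ?_ (keptWeight_nonneg hp0 hp1 t)
  refine le_min ?_ (div_le_div_of_nonneg_right (hg2 t) hm'.le)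
  rw [div_le_one hm']
  refine (sum_le_sum fun k _ => hg1 t k).trans ?_
  simp

end Erasure

end Converse

/-! ### Random coding -/

section RandomCoding

open Finset Matrix

variable {d n m : ℕ}

lemma pSucc_le (hd : 1 ≤ d) {p : ℝ} (hp0 : 0 ≤ p) (hp1 : p ≤ 1) (hm : 1 ≤ m) :
    pSucc (tensorPower (erasureChannel d p) n) m ≤
      binExp (1 - p) n fun k => min 1 ((d : ℝ) ^ k / m) := by
  refine Real.sSup_le ?_ ?_
  · rintro s ⟨enc, dec, henc, hdec, rfl⟩
    exact codeSuccess_le hd hp0 hp1 hm henc hdec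
  · have := binExp_mono (q := 1 - p) (by linarith) (by linarith) (n := n) (F := fun _ => 0)
      (G := fun k => min 1 ((d : ℝ) ^ k / m)) fun k _ => by positivity
    rwa [binExp_const] at this

lemma codeSuccess_le_pSucc (hd : 1 ≤ d) {p : ℝ} (hp0 : 0 ≤ p) (hp1 : p ≤ 1) (hm : 1 ≤ m)
    {enc : Matrix (Fin m) (Fin m) ℂ →ₗ[ℂ] Matrix (Fin n → Fin d) (Fin n → Fin d) ℂ}
    {dec : Matrix (Fin n → Fin d ⊕ Unit) (Fin n → Fin d ⊕ Unit) ℂ →ₗ[ℂ]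
      Matrix (Fin m) (Fin m) ℂ} (henc : IsChannel enc) (hdec : IsChannel dec) :
    codeSuccess (tensorPower (erasureChannel d p) n) m enc dec ≤
      pSucc (tensorPower (erasureChannel d p) n) m := by
  refine le_csSup ⟨binExp (1 - p) n fun k => min 1 ((d : ℝ) ^ k / m), ?_⟩
    ⟨enc, dec, henc, hdec, rfl⟩
  rintro s ⟨enc, dec, henc, hdec, rfl⟩
  exact codeSuccess_le hd hp0 hp1 hm henc hdec

lemma erased_inj {t t' : Finset (Fin n)} {x x' : Fin n → Fin d}
    (h : erased t x = erased t' x') : ∀ i ∈ t, x i = x' i := by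
  intro i hi
  have := congrFun h i
  by_cases hi' : i ∈ t' <;> simp_all [erased]

/-- The decoder of the classical code with codewords `c`: output any message whose codeword agrees
with the received string on the unerased sites. -/
def codeDecoder (hm : 1 ≤ m) (c : Fin m → Fin n → Fin d) (b : Fin n → Fin d ⊕ Unit) : Fin m :=
  open Classical in if h : ∃ k, ∃ t, b = erased t (c k) then h.choose else ⟨0, hm⟩

lemma codeDecoder_erased (hm : 1 ≤ m) (c : Fin m → Fin n → Fin d) (t : Finset (Fin n)) (k : Fin m)
    (h : ∀ l, l ≠ k → ¬ ∀ i ∈ t, c k i = c l i) : codeDecoder hm c (erased t (c k)) = k := by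
  have hex : ∃ k', ∃ t', erased t (c k) = erased t' (c k') := ⟨k, t, rfl⟩
  rw [codeDecoder, dif_pos hex]
  by_contra hne
  obtain ⟨t', ht'⟩ := hex.choose_spec
  exact h _ hne (erased_inj ht')

/-- The success probability of a code with classical codewords `c` and decoder `g`. -/
lemma codeSuccess_classical (p : ℝ) (c : Fin m → Fin n → Fin d)
    (g : (Fin n → Fin d ⊕ Unit) → Fin m) :
    codeSuccess (tensorPower (erasureChannel d p) n) m (classicalChannel c) (classicalChannel g) =
      (1 / (m : ℝ)) * ∑ k, ∑ t : Finset (Fin n),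
        keptWeight p t * if g (erased t (c k)) = k then 1 else 0 := by
  simp only [codeSuccess, trace_mul_single_self, classicalChannel_single,
    tensorPower_erasureChannel, map_sum, map_smul, Matrix.sum_apply, Matrix.smul_apply,
    Complex.re_sum, smul_eq_mul, Complex.re_ofReal_mul, classicalChannel_apply_self,
    keptOutput_single_self]
  congr 1
  refine sum_congr rfl fun k _ => sum_congr rfl fun t _ => ?_
  congr 1
  rw [sum_eq_single (erased t (c k))]
  · rw [if_pos rfl]; split_ifs <;> simp
  · intro b _ hb; simp [hb]
  · simp

/-- The words at two distinct positions of a uniformly random code agree on `t` with probability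
at most `d ^ (-#t)`. -/
lemma card_collision_mul_le (t : Finset (Fin n)) {k l : Fin m} (hkl : l ≠ k) :
    #{c : Fin m → Fin n → Fin d | ∀ i ∈ t, c k i = c l i} * d ^ #t ≤
      Fintype.card (Fin m → Fin n → Fin d) := by
  classical
  have h1 : d ^ #t = Fintype.card (t → Fin d) := by simp
  rw [h1, ← Fintype.card_coe, ← Fintype.card_prod]
  -- Overwrite the `l`-th word on `t`: the old values are recovered from the `k`-th word.
  let f : {c // c ∈ ({c : Fin m → Fin n → Fin d | ∀ i ∈ t, c k i = c l i} : Finset _)} ×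
      (t → Fin d) → (Fin m → Fin n → Fin d) := fun x =>
    Function.update x.1.1 l fun i => if h : i ∈ t then x.2 ⟨i, h⟩ else x.1.1 l i
  refine Fintype.card_le_of_injective f ?_
  rintro ⟨⟨c, hc⟩, v⟩ ⟨⟨c', hc'⟩, v'⟩ h
  simp only [mem_filter, mem_univ, true_and] at hc hc'
  have hrow : ∀ j, j ≠ l → c j = c' j := by
    intro j hj
    have := congrFun h j
    simpa [f, Function.update_of_ne hj] using this
  have hl : ∀ i, (if h : i ∈ t then v ⟨i, h⟩ else c l i) =
      if h : i ∈ t then v' ⟨i, h⟩ else c' l i := by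
    intro i
    have := congrFun (congrFun h l) i
    simpa [f] using this
  have hv : v = v' := by
    funext ⟨i, hi⟩
    simpa [hi] using hl i
  have hcc : c = c' := by
    funext j
    by_cases hj : j = l
    · subst hj
      funext i
      by_cases hi : i ∈ t
      · rw [← hc i hi, ← hc' i hi, hrow k hkl.symm]
      · simpa [hi] using hl i
    · exact hrow j hj
  subst hv hcc
  rfl

/-- Random coding: some classical code achieves success probability
`P(K ≥ j) (1 - (m - 1) / d ^ j)`, where `K` is the number of unerased sites. -/
lemma le_pSucc (hd : 1 ≤ d) {p : ℝ} (hp0 : 0 ≤ p) (hp1 : p ≤ 1) (hm : 1 ≤ m) (j : ℕ) :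
    (1 - binLT (1 - p) n j) * (1 - (m - 1) / (d : ℝ) ^ j) ≤
      pSucc (tensorPower (erasureChannel d p) n) m := by
  classical
  have hd' : (1 : ℝ) ≤ d := by exact_mod_cast hd
  have hm' : (0 : ℝ) < m := by exact_mod_cast hm
  set V : ℝ := (Fintype.card (Fin m → Fin n → Fin d) : ℝ) with hV
  have hVpos : 0 < V := by
    have : Nonempty (Fin d) := ⟨⟨0, hd⟩⟩
    exact Nat.cast_pos.2 Fintype.card_pos
  set coll : Finset (Fin n) → Fin m → Fin m → (Fin m → Fin n → Fin d) → ℝ :=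
    fun t k l c => if ∀ i ∈ t, c k i = c l i then 1 else 0 with hcoll
  have hcollsum : ∀ t k l, l ≠ k → ∑ c, coll t k l c ≤ V / (d : ℝ) ^ #t := by
    intro t k l hkl
    rw [le_div_iff₀ (by positivity)]
    have := card_collision_mul_le (d := d) t hkl
    simp only [hcoll, sum_boole, hV]
    exact_mod_cast this
  -- For a fixed message and erasure pattern, the union bound over the competing codewords.
  have hunion : ∀ (t : Finset (Fin n)) (k : Fin m), j ≤ #t →
      V * (1 - (m - 1) / (d : ℝ) ^ j) ≤
        ∑ c : Fin m → Fin n → Fin d,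
          if codeDecoder hm c (erased t (c k)) = k then (1 : ℝ) else 0 := by
    intro t k ht
    have h1 : ∀ c : Fin m → Fin n → Fin d, 1 - ∑ l ∈ univ.erase k, coll t k l c ≤
        if codeDecoder hm c (erased t (c k)) = k then (1 : ℝ) else 0 := by
      intro c
      have hnn : ∀ l, 0 ≤ coll t k l c := fun l => by simp only [hcoll]; split_ifs <;> simp
      split_ifs with h
      · have := sum_nonneg (s := univ.erase k) fun l _ => hnn l
        linarith
      · have h2 : ∃ l, l ≠ k ∧ ∀ i ∈ t, c k i = c l i := by
          by_contra hcon
          push Not at hcon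
          refine h (codeDecoder_erased hm c t k fun l hl h3 => ?_)
          obtain ⟨i, hi, hne⟩ := hcon l hl
          exact hne (h3 i hi)
        obtain ⟨l, hl, h3⟩ := h2
        have h4 := single_le_sum (f := fun l => coll t k l c) (fun l _ => hnn l)
          (mem_erase.2 ⟨hl, mem_univ l⟩)
        have h5 : coll t k l c = 1 := if_pos h3
        simp only [h5] at h4
        linarith
    refine le_trans ?_ (sum_le_sum fun c _ => h1 c)
    rw [sum_sub_distrib, sum_comm]
    have h2 : ∑ l ∈ univ.erase k, ∑ c, coll t k l c ≤ ((m : ℝ) - 1) * (V / (d : ℝ) ^ j) := by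
      calc _ ≤ ∑ l ∈ univ.erase k, V / (d : ℝ) ^ j := by
            refine sum_le_sum fun l hl => (hcollsum t k l (mem_erase.1 hl).1).trans ?_
            gcongr
        _ = _ := by
            rw [sum_const, card_erase_of_mem (mem_univ k), card_univ, Fintype.card_fin,
              nsmul_eq_mul, Nat.cast_pred hm]
    have h3 : ∑ _c : Fin m → Fin n → Fin d, (1 : ℝ) = V := by simp [hV]
    rw [h3]
    have h4 : V * (1 - (m - 1) / (d : ℝ) ^ j) = V - (m - 1) * (V / (d : ℝ) ^ j) := by ring
    linarith
  have hbin : 1 - binLT (1 - p) n j =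
      ∑ t : Finset (Fin n), keptWeight p t * if j ≤ #t then 1 else 0 := by
    rw [sum_keptWeight p fun k => if j ≤ k then 1 else 0, binLT, sub_eq_iff_eq_add, ← binExp_add]
    refine (binExp_const (1 - p) 1 n).symm.trans ?_
    congr 1; funext k
    by_cases h : j ≤ k
    · simp [h, not_lt.2 h]
    · simp [h, not_le.1 h]
  have hsum : V * ((1 - binLT (1 - p) n j) * (1 - (m - 1) / (d : ℝ) ^ j)) ≤
      ∑ c : Fin m → Fin n → Fin d, codeSuccess (tensorPower (erasureChannel d p) n) m
        (classicalChannel c) (classicalChannel (codeDecoder hm c)) := by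
    simp only [codeSuccess_classical]
    rw [← mul_sum, sum_comm]
    have h1 : ∀ k : Fin m, V * ((1 - binLT (1 - p) n j) * (1 - (m - 1) / (d : ℝ) ^ j)) ≤
        ∑ c : Fin m → Fin n → Fin d, ∑ t : Finset (Fin n), keptWeight p t *
          if codeDecoder hm c (erased t (c k)) = k then (1 : ℝ) else 0 := by
      intro k
      rw [sum_comm, hbin, sum_mul, mul_sum]
      refine sum_le_sum fun t _ => ?_
      rw [← mul_sum]
      have hw := keptWeight_nonneg hp0 hp1 t
      split_ifs with ht
      · calc _ = keptWeight p t * (V * (1 - (m - 1) / (d : ℝ) ^ j)) := by ring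
          _ ≤ _ := mul_le_mul_of_nonneg_left (hunion t k ht) hw
      · rw [mul_zero, zero_mul, mul_zero]
        refine mul_nonneg hw (sum_nonneg fun c _ => ?_)
        split_ifs <;> simp
    have h2 := sum_le_sum fun (k : Fin m) (_ : k ∈ univ) => h1 k
    rw [sum_const, card_univ, Fintype.card_fin, nsmul_eq_mul] at h2
    rw [one_div, inv_mul_eq_div, le_div_iff₀ hm', mul_comm]
    exact h2
  have hsup : ∑ c : Fin m → Fin n → Fin d, codeSuccess (tensorPower (erasureChannel d p) n) m
        (classicalChannel c) (classicalChannel (codeDecoder hm c)) ≤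
      V * pSucc (tensorPower (erasureChannel d p) n) m := by
    refine (sum_le_sum fun c _ => codeSuccess_le_pSucc hd hp0 hp1 hm
      (isChannel_classicalChannel c) (isChannel_classicalChannel (codeDecoder hm c))).trans ?_
    rw [sum_const, card_univ, nsmul_eq_mul]
  exact le_of_mul_le_mul_left (hsum.trans hsup) hVpos

end RandomCoding

/-! ### Capacity bounds and the binomial quantile -/

section CapacityBounds

open Finset Filter
open scoped Topology

section Capacity
variable {d n : ℕ}

lemma binLT_nonneg {q : ℝ} (hq0 : 0 ≤ q) (hq1 : q ≤ 1) (n j : ℕ) : 0 ≤ binLT q n j := by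
  have := binExp_mono hq0 hq1 (n := n) (F := fun _ => 0) (G := fun k => if k < j then 1 else 0)
    fun k _ => by positivity
  rwa [binExp_const] at this

lemma binLT_zero (q : ℝ) (n : ℕ) : binLT q n 0 = 0 := by
  simp [binLT, binExp_const]

lemma binLT_succ_self {q : ℝ} (hq0 : 0 ≤ q) (hq1 : q ≤ 1) (n : ℕ) : binLT q n (n + 1) = 1 := by
  rw [binLT]
  refine Eq.trans (le_antisymm ?_ ?_) (binExp_const q 1 n)
  · exact binExp_mono hq0 hq1 fun k hk => by simp [Nat.lt_succ_of_le hk]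
  · exact binExp_mono hq0 hq1 fun k hk => by simp [Nat.lt_succ_of_le hk]

/-- Converse: if `P(K < j)` exceeds `ε` by `δ`, then the capacity is at most
`j log d + log (1 / δ)`. -/
lemma oneShotCapacity_le (hd : 1 ≤ d) {p ε δ : ℝ} (hp0 : 0 ≤ p) (hp1 : p ≤ 1) (hδ : 0 < δ) {j : ℕ}
    (h : ε + δ ≤ binLT (1 - p) n j) :
    oneShotCapacity (tensorPower (erasureChannel d p) n) ε ≤
      ((j * Real.logb 2 d - Real.logb 2 δ : ℝ) : EReal) := by
  refine sSup_le ?_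
  rintro r ⟨m, hm, hsucc, rfl⟩
  have hd' : (1 : ℝ) ≤ d := by exact_mod_cast hd
  have hm' : (0 : ℝ) < m := by exact_mod_cast hm
  have h1 : pSucc (tensorPower (erasureChannel d p) n) m ≤
      1 - binLT (1 - p) n j + (d : ℝ) ^ j / m := by
    refine (pSucc_le hd hp0 hp1 hm).trans ?_
    refine (binExp_mono (G := fun k => 1 - (if k < j then 1 else 0) + (d : ℝ) ^ j / m)
      (by linarith) (by linarith) fun k _ => ?_).trans (le_of_eq ?_)
    · split_ifs with hk
      · rw [sub_self, zero_add]
        refine (min_le_right _ _).trans ?_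
        gcongr
      · have : 0 ≤ (d : ℝ) ^ j / m := by positivity
        exact (min_le_left _ _).trans (by linarith)
    · rw [binExp_add, binExp_sub, binExp_const, binExp_const, binLT]
  have h2 : δ ≤ (d : ℝ) ^ j / m := by linarith
  have h3 : (m : ℝ) ≤ (d : ℝ) ^ j / δ := by
    rw [le_div_iff₀ hm'] at h2
    rw [le_div_iff₀ hδ]
    linarith
  have h4 := Real.logb_le_logb_of_le one_lt_two hm' h3
  rw [Real.logb_div (by positivity) hδ.ne', Real.logb_pow] at h4
  exact_mod_cast h4

/-- Achievability: if `P(K < j)` is below `ε` by `δ`, then the capacity is at least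
`j log d - log (1 / δ)`. -/
lemma le_oneShotCapacity (hd : 1 ≤ d) {p ε δ : ℝ} (hp0 : 0 ≤ p) (hp1 : p ≤ 1) (hε : ε < 1)
    (hδ : 0 < δ) {j : ℕ} (h : binLT (1 - p) n j ≤ ε - δ) :
    ((j * Real.logb 2 d + Real.logb 2 δ : ℝ) : EReal) ≤
      oneShotCapacity (tensorPower (erasureChannel d p) n) ε := by
  have hd' : (1 : ℝ) ≤ d := by exact_mod_cast hd
  have hdj : (0 : ℝ) < (d : ℝ) ^ j := by positivity
  have hB := binLT_nonneg (q := 1 - p) (by linarith) (by linarith) n j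
  -- The largest number of messages for which the union bound costs at most `δ`.
  set m : ℕ := ⌊(d : ℝ) ^ j * δ⌋₊ + 1 with hm
  have hm1 : ((m : ℝ) - 1) / (d : ℝ) ^ j ≤ δ := by
    rw [div_le_iff₀ hdj, hm]
    push_cast
    have := Nat.floor_le (a := (d : ℝ) ^ j * δ) (by positivity)
    linarith
  have hsucc : 1 - ε ≤ pSucc (tensorPower (erasureChannel d p) n) m := by
    refine le_trans ?_ (le_pSucc hd hp0 hp1 (m := m) (by omega) j)
    have h1 : (1 - ε + δ) * (1 - δ) ≤ (1 - binLT (1 - p) n j) * (1 - ((m : ℝ) - 1) / (d : ℝ) ^ j) :=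
      mul_le_mul (by linarith) (by linarith) (by linarith) (by linarith)
    nlinarith
  have hlog : j * Real.logb 2 d + Real.logb 2 δ ≤ Real.logb 2 m := by
    rw [← Real.logb_pow, ← Real.logb_mul hdj.ne' hδ.ne']
    refine Real.logb_le_logb_of_le one_lt_two (by positivity) ?_
    rw [hm]
    push_cast
    exact (Nat.lt_floor_add_one _).le
  exact (EReal.coe_le_coe_iff.2 hlog).trans (le_sSup ⟨m, by omega, hsucc, rfl⟩)

end Capacity

section Quantile

lemma strictMono_stdCDF : StrictMono stdCDF :=
  strictMono_of_deriv_pos fun x => by rw [(hasDerivAt_stdCDF x).deriv]; exact stdPDF_pos x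

lemma stdCDF_stdNormalQuantile {ε : ℝ} (hε0 : 0 < ε) (hε1 : ε < 1) :
    stdCDF (stdNormalQuantile ε) = ε := by
  obtain ⟨x, hx⟩ : ∃ x, stdCDF x = ε := by
    have h0 : ∃ a, stdCDF a < ε :=
      ((ProbabilityTheory.tendsto_cdf_atBot (ProbabilityTheory.gaussianReal 0 1)).eventually
        (gt_mem_nhds hε0)).exists
    have h1 : ∃ b, ε < stdCDF b :=
      ((ProbabilityTheory.tendsto_cdf_atTop (ProbabilityTheory.gaussianReal 0 1)).eventually
        (lt_mem_nhds hε1)).exists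
    obtain ⟨a, ha⟩ := h0
    obtain ⟨b, hb⟩ := h1
    exact mem_range_of_exists_le_of_exists_ge continuous_stdCDF ⟨a, ha.le⟩ ⟨b, hb.le⟩
  have hset : {y : ℝ | ε ≤ ProbabilityTheory.cdf (ProbabilityTheory.gaussianReal 0 1) y} =
      Set.Ici x := by
    ext y
    rw [Set.mem_ofPred_eq, Set.mem_Ici, ← hx]
    exact strictMono_stdCDF.le_iff_le
  rw [stdNormalQuantile, hset, csInf_Ici, hx]

/-- On an interval `[y, y + s]` contained in `[-x, x]` the slope of `Φ` is at least `φ(x)`. -/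
lemma stdCDF_slope {x s : ℝ} (y : ℝ) (hs : 0 ≤ s) (hy : |y| + s ≤ x) :
    stdCDF y + stdPDF x * s ≤ stdCDF (y + s) := by
  have h := (convex_Icc y (y + s)).mul_sub_le_image_sub_of_le_deriv (f := stdCDF) (C := stdPDF x)
    continuous_stdCDF.continuousOn
    (fun w _ => (hasDerivAt_stdCDF w).differentiableAt.differentiableWithinAt)
    (fun w hw => by
      have hw' := interior_subset hw
      rw [(hasDerivAt_stdCDF w).deriv]
      refine stdPDF_le_of_abs_le ?_
      refine le_trans ?_ (le_abs_self x)
      refine le_trans ?_ hy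
      rw [abs_le]
      constructor <;> linarith [neg_abs_le y, le_abs_self y, hw'.1, hw'.2])
    y (Set.left_mem_Icc.2 (by linarith)) (y + s) (Set.right_mem_Icc.2 (by linarith)) (by linarith)
  rw [add_sub_cancel_left] at h
  linarith

lemma binExp_one (n : ℕ) (F : ℕ → ℝ) : binExp 1 n F = F n := by
  induction n generalizing F with
  | zero => rfl
  | succ n ih => rw [binExp_succ, ih]; ring

lemma binExp_zero (n : ℕ) (F : ℕ → ℝ) : binExp 0 n F = F 0 := by
  induction n generalizing F with
  | zero => rfl
  | succ n ih => rw [binExp_succ, ih]; ring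

/-- The `ε`-quantile of the binomial law with `n` trials is `n q + √(n q p) Φ⁻¹(ε) + O(1)`, even
after perturbing `ε` by an amount of order `1 / √n`. -/
lemma exists_binLT_quantile {p ε : ℝ} (hp0 : 0 ≤ p) (hp1 : p ≤ 1) (hε0 : 0 < ε) (hε1 : ε < 1) :
    ∃ D κ : ℝ, 0 < κ ∧ ∀ᶠ n : ℕ in atTop, ∃ j₁ j₂ : ℕ,
      binLT (1 - p) n j₁ ≤ ε - κ / √(n + 1) ∧ ε + κ / √(n + 1) ≤ binLT (1 - p) n j₂ ∧
      n * (1 - p) + √(n * p * (1 - p)) * stdNormalQuantile ε - D ≤ j₁ ∧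
      j₂ ≤ n * (1 - p) + √(n * p * (1 - p)) * stdNormalQuantile ε + D := by
  have hdeg : ∀ n : ℕ, min ε (1 - ε) / √((n : ℝ) + 1) ≤ min ε (1 - ε) := fun n =>
    div_le_self (le_min hε0.le (by linarith))
      (Real.one_le_sqrt.2 (by linarith [n.cast_nonneg (α := ℝ)]))
  have hκ : 0 < min ε (1 - ε) := lt_min hε0 (by linarith)
  -- For `p = 0` and `p = 1` the law is a point mass, at `n` and `0` respectively.
  rcases hp0.eq_or_lt with rfl | hp0
  · refine ⟨1, min ε (1 - ε), hκ, Eventually.of_forall fun n => ⟨n, n + 1, ?_, ?_, ?_, ?_⟩⟩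
    · have := hdeg n
      simp only [binLT, sub_zero, binExp_one, lt_irrefl, if_false]
      linarith [min_le_left ε (1 - ε)]
    · have := hdeg n
      simp only [binLT, sub_zero, binExp_one, Nat.lt_succ_self, if_true]
      linarith [min_le_right ε (1 - ε)]
    · simp
    · simp
  rcases hp1.eq_or_lt with rfl | hp1
  · refine ⟨1, min ε (1 - ε), hκ, Eventually.of_forall fun n => ⟨0, 1, ?_, ?_, ?_, ?_⟩⟩
    · have := hdeg n
      simp only [binLT, sub_self, binExp_zero, lt_irrefl, if_false]
      linarith [min_le_left ε (1 - ε)]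
    · have := hdeg n
      simp only [binLT, sub_self, binExp_zero, zero_lt_one, if_true]
      linarith [min_le_right ε (1 - ε)]
    · simp
    · simp
  obtain ⟨C, hC, hBE⟩ := binLT_sub_stdCDF_le (q := 1 - p) (by linarith) (by linarith)
  set q : ℝ := 1 - p with hq
  have hq0 : 0 < q := by linarith
  have hq1 : q ≤ 1 := by linarith
  have h1q : 1 - q = p := by ring
  set x := stdNormalQuantile ε with hx
  have hΦx : stdCDF x = ε := stdCDF_stdNormalQuantile hε0 hε1
  set c : ℝ := stdPDF (|x| + 2) with hc
  have hcpos : 0 < c := stdPDF_pos _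
  -- The shift `s = (C + 1) / (c √(n + 1))` of the argument of `Φ` pays for the Berry–Esseen error
  -- `C / √(n + 1)` and the margin `1 / √(n + 1)`; times the standard deviation it is bounded.
  refine ⟨2 + (C + 1) / c + |x|, 1, one_pos, ?_⟩
  have hlarge : Tendsto (fun n : ℕ => √((n : ℝ) + 1)) atTop atTop :=
    Real.tendsto_sqrt_atTop.comp
      (tendsto_atTop_add_const_right _ _ tendsto_natCast_atTop_atTop)
  filter_upwards [hlarge.eventually_ge_atTop ((C + 1) / c),
    hlarge.eventually_ge_atTop ((|x| + 1) / q)] with n hn1 hn2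
  have hN : (0 : ℝ) < (n : ℝ) + 1 := by positivity
  set R : ℝ := √((n : ℝ) + 1) with hR
  have hRpos : 0 < R := Real.sqrt_pos.2 hN
  have hR2 : R ^ 2 = n + 1 := Real.sq_sqrt hN.le
  have hBE' := hBE n
  rw [h1q] at hBE'
  set σ : ℝ := √((n + 1) * q * p) with hσ
  have hσpos : 0 < σ := by positivity
  have hσR : σ ≤ R := by
    refine Real.sqrt_le_sqrt ?_
    rw [mul_assoc]
    exact mul_le_of_le_one_right hN.le (by nlinarith)
  set s : ℝ := (C + 1) / (c * R) with hs
  have hspos : 0 < s := by positivity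
  have hsR : R * s = (C + 1) / c := by rw [hs]; field_simp
  have hcs : c * s = C / R + 1 / R := by rw [hs]; field_simp
  have hs1 : s ≤ 1 := by
    rw [hs, div_le_one (by positivity)]
    rwa [div_le_iff₀ hcpos, mul_comm] at hn1
  have hσs : σ * s ≤ (C + 1) / c := by rw [← hsR]; gcongr
  have hnonneg : σ * (|x| + 1) ≤ (n + 1) * q := by
    rw [div_le_iff₀ hq0] at hn2
    calc σ * (|x| + 1) ≤ R * (R * q) := by gcongr
      _ = _ := by rw [← hR2]; ring
  have hup : stdCDF x + c * s ≤ stdCDF (x + s) := stdCDF_slope x hspos.le (by linarith)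
  have hdown : stdCDF (x - s) + c * s ≤ stdCDF x := by
    have := stdCDF_slope (x := |x| + 2) (x - s) hspos.le (by
      have := abs_sub x s
      rw [abs_of_pos hspos] at this
      linarith)
    rwa [sub_add_cancel] at this
  have hσ' : |σ - √(n * p * q)| ≤ 1 := by
    have h1 : √(n * p * q) ≤ σ := Real.sqrt_le_sqrt (by nlinarith [mul_pos hq0 hp0])
    have h2 : σ ≤ √(n * p * q) + √(p * q) := by
      rw [hσ, show ((n : ℝ) + 1) * q * p = n * p * q + p * q by ring]
      refine Real.sqrt_le_iff.2 ⟨by positivity, ?_⟩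
      rw [add_sq, Real.sq_sqrt (by positivity), Real.sq_sqrt (by positivity)]
      have : 0 ≤ 2 * √(n * p * q) * √(p * q) := by positivity
      linarith
    have h3 : √(p * q) ≤ 1 := Real.sqrt_le_one.2 (by nlinarith)
    rw [abs_le]
    constructor <;> linarith
  have hσx : |σ * x - √(n * p * q) * x| ≤ |x| := by
    rw [← sub_mul, abs_mul]
    exact mul_le_of_le_one_left (abs_nonneg x) hσ'
  have hσx' := abs_le.1 hσx
  have hxabs : -(σ * |x|) ≤ σ * x := by nlinarith [neg_abs_le x]
  have hσs1 : σ * s ≤ σ := mul_le_of_le_one_right hσpos.le hs1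
  have hσs0 : 0 ≤ σ * s := by positivity
  rw [mul_add, mul_one] at hnonneg
  have e₁ : (n + 1) * q + σ * (x - s) = n * q + q + σ * x - σ * s := by ring
  have e₂ : (n + 1) * q + σ * (x + s) = n * q + q + σ * x + σ * s := by ring
  have hval₁ : 0 ≤ (n + 1) * q + σ * (x - s) := by linarith
  have hval₂ : 0 ≤ (n + 1) * q + σ * (x + s) := by linarith
  refine ⟨⌊(n + 1) * q + σ * (x - s)⌋₊, ⌈(n + 1) * q + σ * (x + s)⌉₊, ?_, ?_, ?_, ?_⟩
  · have h1 := Nat.floor_le hval₁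
    have h2 := (abs_le.1 (hBE' ⌊(n + 1) * q + σ * (x - s)⌋₊)).2
    have h3 : stdCDF (((⌊(n + 1) * q + σ * (x - s)⌋₊ : ℝ) - (n + 1) * q) / σ) ≤
        stdCDF (x - s) := monotone_stdCDF (by
      rw [div_le_iff₀ hσpos]; linarith)
    linarith
  · have h1 := Nat.le_ceil ((n + 1) * q + σ * (x + s))
    have h2 := (abs_le.1 (hBE' ⌈(n + 1) * q + σ * (x + s)⌉₊)).1
    have h3 : stdCDF (x + s) ≤
        stdCDF (((⌈(n + 1) * q + σ * (x + s)⌉₊ : ℝ) - (n + 1) * q) / σ) := monotone_stdCDF (by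
      rw [le_div_iff₀ hσpos]; linarith)
    linarith
  · have h1 := Nat.lt_floor_add_one ((n + 1) * q + σ * (x - s))
    linarith
  · have h1 := Nat.ceil_lt_add_one hval₂
    linarith

end Quantile

end CapacityBounds

end QErasure

end

theorem theorem4 (d : ℕ) (hd : 1 ≤ d) (p : ℝ) (hp0 : 0 ≤ p) (hp1 : p ≤ 1)
    (ε : ℝ) (hε0 : 0 < ε) (hε1 : ε < 1) :
    ∃ r : ℕ → ℝ,
      r =O[Filter.atTop] (fun n : ℕ => Real.log (n : ℝ)) ∧
      ∀ n : ℕ,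
        QErasure.oneShotCapacity (QErasure.tensorPower (QErasure.erasureChannel d p) n) ε =
          (((n : ℝ) * (1 - p) * Real.logb 2 (d : ℝ) +
            Real.sqrt ((n : ℝ) * p * (1 - p) * (Real.logb 2 (d : ℝ)) ^ 2) *
              QErasure.stdNormalQuantile ε +
            r n : ℝ) : EReal) := by
  open QErasure in
  set C : ℕ → EReal := fun n => oneShotCapacity (tensorPower (erasureChannel d p) n) ε with hC
  set a : ℝ := Real.logb 2 (d : ℝ) with ha
  have ha0 : 0 ≤ a := Real.logb_nonneg one_lt_two (by exact_mod_cast hd)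
  set x := QErasure.stdNormalQuantile ε with hx
  -- Taking `j = n + 1` and `j = 0` in the two capacity bounds shows that the capacity is finite.
  have hfin : ∀ n, ((C n).toReal : EReal) = C n := by
    intro n
    have hup := QErasure.oneShotCapacity_le (n := n) (j := n + 1) (ε := ε) (δ := 1 - ε) hd hp0 hp1
      (by linarith) (by
        rw [QErasure.binLT_succ_self (by linarith) (by linarith)]; linarith)
    have hlow := QErasure.le_oneShotCapacity (n := n) (j := 0) (δ := ε) hd hp0 hp1 hε1 hε0
      (by rw [QErasure.binLT_zero]; linarith)
    refine EReal.coe_toReal (fun h => ?_) (fun h => ?_)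
    · rw [show QErasure.oneShotCapacity _ _ = ⊤ from h] at hup
      exact (EReal.coe_lt_top _).not_ge hup
    · rw [show QErasure.oneShotCapacity _ _ = ⊥ from h] at hlow
      exact (EReal.bot_lt_coe _).not_ge hlow
  have hsqrt : ∀ n : ℕ, √((n : ℝ) * p * (1 - p) * a ^ 2) = √(n * p * (1 - p)) * a := by
    intro n
    rw [Real.sqrt_mul' _ (sq_nonneg a), Real.sqrt_sq ha0]
  refine ⟨fun n => (C n).toReal - (n * (1 - p) * a + √(n * p * (1 - p) * a ^ 2) * x), ?_,
    fun n => ?_⟩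
  swap
  · rw [add_sub_cancel]
    exact (hfin n).symm
  obtain ⟨D, κ, hκ, hev⟩ := QErasure.exists_binLT_quantile hp0 hp1 hε0 hε1
  set K : ℝ := D * a + |Real.logb 2 κ| with hK
  have hlog2 : 0 < Real.log 2 := Real.log_pos one_lt_two
  refine Asymptotics.IsBigO.of_bound ((|K| + 1) / Real.log 2) ?_
  filter_upwards [hev, Filter.eventually_ge_atTop 2] with n hn hn2
  obtain ⟨j₁, j₂, h1, h2, h3, h4⟩ := hn
  have hn2' : (2 : ℝ) ≤ n := by exact_mod_cast hn2
  have hδ : 0 < κ / √((n : ℝ) + 1) := by positivity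
  have hlow := QErasure.le_oneShotCapacity hd hp0 hp1 hε1 hδ h1
  have hup := QErasure.oneShotCapacity_le hd hp0 hp1 hδ h2
  rw [← show C n = QErasure.oneShotCapacity _ _ from rfl, ← hfin n, EReal.coe_le_coe_iff,
    ← ha] at hlow hup
  have hlogδ : |Real.logb 2 (κ / √((n : ℝ) + 1))| ≤ |Real.logb 2 κ| + Real.log n / Real.log 2 := by
    rw [Real.logb_div hκ.ne' (by positivity)]
    refine (abs_sub _ _).trans ?_
    gcongr
    rw [Real.logb, Real.log_sqrt (by positivity), abs_of_nonneg (by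
      have : 0 ≤ Real.log ((n : ℝ) + 1) := Real.log_nonneg (by linarith)
      positivity)]
    gcongr
    have : Real.log ((n : ℝ) + 1) ≤ Real.log ((n : ℝ) ^ 2) :=
      Real.log_le_log (by positivity) (by nlinarith)
    rw [Real.log_pow] at this
    push_cast at this
    linarith
  have hlogδ' := abs_le.1 hlogδ
  have hlogn : 1 ≤ Real.log n / Real.log 2 := by
    rw [one_le_div hlog2]
    exact Real.log_le_log two_pos hn2'
  have h3' := mul_le_mul_of_nonneg_right h3 ha0
  have h4' := mul_le_mul_of_nonneg_right h4 ha0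
  have hfinal : |(C n).toReal - (n * (1 - p) * a + √(n * p * (1 - p) * a ^ 2) * x)| ≤
      K + Real.log n / Real.log 2 := by
    rw [hsqrt, abs_le, hK]
    constructor <;> linarith
  rw [Real.norm_eq_abs, Real.norm_eq_abs,
    abs_of_nonneg (Real.log_nonneg (by linarith : (1 : ℝ) ≤ n))]
  refine hfinal.trans ?_
  rw [div_mul_eq_mul_div, mul_div_assoc, add_mul, one_mul]
  have := le_mul_of_one_le_right (abs_nonneg K) hlogn
  linarith [le_abs_self K]
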